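/- For a compactly supported Borel probability measure $\tau$ on $\mathbb{C}$ let $I(\tau)=\iint\log\frac{1}{|z-t|}\,d\tau(z)\,d\tau(t)\in(-\infty,+\infty]$; a set $E\subset\mathbb{C}$ is called polar if $I(\tau)=+\infty$ for every probability measure $\tau$ carried by a compact subset of $E$. An admissible weight on a compact set $K\subset\mathbb{C}$ is a nonnegative upper semicontinuous function $w=e^{-Q}$ on $K$ such that $\{z\in K:w(z)>0\}$ is nonpolar. For points $z_0,\dots,z_n$ put $VDM(z_0,\dots,z_n)=\det[z_i^{\,j}]_{i,j=0,\dots,n}$, and let $$\delta^w(K)=\lim_{n\to\infty}\Bigl[\max_{\lambda_0,\dots,\lambda_n\in K}|VDM(\lambda_0,\dots,\lambda_n)|\,w(\lambda_0)^n\cdots w(\lambda_n)^n\Bigr]^{1/\binom{n+1}{2}}$$ be the weighted transfinite diameter. For a probability measure $\tau$ on $K$ let $$I^w(\tau)=\int_K\int_K\log\frac{1}{|z-t|\,w(z)w(t)}\,d\tau(t)\,d\tau(z).$$ **Proposition.** Let $K\subset\mathbb{C}$ be compact and nonpolar, and let $\{K_n\}$ be any sequence of compact sets decreasing to $K$, i.e.,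 $K_{n+1}\subset K_n$ for all $n$ and $K=\bigcap_n K_n$. Let $w$ be a function which, for some $n_0$, is an admissible weight on $K_n$ for all $n\ge n_0$, and whose restriction to $K$ is admissible. Then the limit defining $\delta^w(K)$ exists, and there is a unique probability measure $\mu_{K,Q}$ on $K$ minimizing $I^w$ among all probability measures on $K$. Moreover, for every array of points $\{z_{nj}\}_{j=0,\dots,n;\ n=1,2,\dots}$ with $z_{n0},\dots,z_{nn}\in K_n$, if $$\lim_{n\to\infty}\bigl[|VDM(z_{n0},\dots,z_{nn})|\,w(z_{n0})^n\cdots w(z_{nn})^n\bigr]^{1/\binom{n+1}{2}}=\delta^w(K),$$ then $$\mu_n:=\frac{1}{n+1}\sum_{j=0}^n\delta_{z_{nj}}\to\mu_{K,Q}\quad\text{weak-*}.$$ -/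

import Mathlib

open Filter Topology MeasureTheory
open scoped ENNReal

noncomputable section

namespace WeightedPotential

/-- The integral in the extended reals: integral of the positive part minus integral of the
negative part. It has its usual meaning whenever one of the two is finite; below it is used only
for functions which are bounded from below on the (compact) set that carries the measure. -/
def eintegral {α : Type*} [MeasurableSpace α] (f : α → EReal) (μ : Measure α) : EReal :=
  ((∫⁻ x, (f x).toENNReal ∂μ : ℝ≥0∞) : EReal) - ((∫⁻ x, (-f x).toENNReal ∂μ : ℝ≥0∞) : EReal)

/-- The kernel `log (1 / (|z - t| w(z) w(t)))`, equal to `+∞` when `|z - t| w(z) w(t) = 0`. -/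
def weightedKernel (w : ℂ → ℝ) (z t : ℂ) : EReal :=
  ENNReal.log (ENNReal.ofReal (‖z - t‖ * w z * w t))⁻¹

/-- The weighted logarithmic energy
`I^w(τ) = ∫∫ log (1 / (|z - t| w(z) w(t))) dτ(t) dτ(z)`, with values in `(-∞, +∞]` when `τ` is
carried by a compact set on which `w` is bounded above. -/
def weightedEnergy (w : ℂ → ℝ) (τ : ProbabilityMeasure ℂ) : EReal :=
  eintegral (fun p : ℂ × ℂ => weightedKernel w p.1 p.2)
    ((τ : Measure ℂ).prod (τ : Measure ℂ))

/-- The logarithmic energy `I(τ) = ∫∫ log (1 / |z - t|) dτ(t) dτ(z)`. -/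
def logEnergy (τ : ProbabilityMeasure ℂ) : EReal :=
  weightedEnergy (fun _ => 1) τ

/-- A subset of the plane is polar if every probability measure carried by a compact subset of it
has logarithmic energy `+∞`. -/
def IsPolar (E : Set ℂ) : Prop :=
  ∀ C : Set ℂ, IsCompact C → C ⊆ E →
    ∀ τ : ProbabilityMeasure ℂ, (τ : Measure ℂ) Cᶜ = 0 → logEnergy τ = ⊤

/-- `w` is an admissible weight on `K`: nonnegative and upper semicontinuous on `K`, with
`{z ∈ K : w(z) > 0}` nonpolar. Only the values of `w` on `K` matter. -/
structure IsAdmissibleWeight (w : ℂ → ℝ) (K : Set ℂ) : Prop where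
  nonneg : ∀ z ∈ K, 0 ≤ w z
  upperSemicontinuousOn : UpperSemicontinuousOn w K
  nonpolar : ¬ IsPolar {z | z ∈ K ∧ 0 < w z}

/-- `|VDM(z_0, …, z_n)| w(z_0)^n ⋯ w(z_n)^n`. -/
def weightedVDM (w : ℂ → ℝ) (n : ℕ) (z : Fin (n + 1) → ℂ) : ℝ :=
  ‖(Matrix.vandermonde z).det‖ * ∏ j, w (z j) ^ n

/-- The `n`-th order weighted diameter
`δ_n^w(K) = [max_{λ_i ∈ K} |VDM(λ_0, …, λ_n)| w(λ_0)^n ⋯ w(λ_n)^n]^{1 / binom(n+1, 2)}`. -/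
def weightedDiameter (w : ℂ → ℝ) (K : Set ℂ) (n : ℕ) : ℝ :=
  (⨆ z : Fin (n + 1) → K, weightedVDM w n (fun j => (z j : ℂ))) ^
    (1 / ((n + 1).choose 2 : ℝ))

/-- The weighted transfinite diameter `δ^w(K) = lim_{n → ∞} δ_n^w(K)`. -/
def weightedTransfiniteDiameter (w : ℂ → ℝ) (K : Set ℂ) : ℝ :=
  limUnder atTop (weightedDiameter w K)

/-- `μ` is a probability measure on `K` minimizing the weighted energy among all probability
measures on `K`. -/
def IsWeightedEquilibriumMeasure (w : ℂ → ℝ) (K : Set ℂ) (μ : ProbabilityMeasure ℂ) : Prop :=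
  (μ : Measure ℂ) Kᶜ = 0 ∧
    ∀ τ : ProbabilityMeasure ℂ, (τ : Measure ℂ) Kᶜ = 0 → weightedEnergy w μ ≤ weightedEnergy w τ

/-- The normalized counting measure `(1 / (n + 1)) ∑_j δ_{z_j}` of `z_0, …, z_n`. -/
def countingMeasure {n : ℕ} (z : Fin (n + 1) → ℂ) : ProbabilityMeasure ℂ :=
  ⟨((n : ℝ≥0∞) + 1)⁻¹ • ∑ j, Measure.dirac (z j), ⟨by
    simp only [Measure.smul_apply, Measure.finsetSum_apply, Measure.dirac_apply_of_mem
      (Set.mem_univ _), Finset.sum_const, Finset.card_univ, Fintype.card_fin, nsmul_eq_mul,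
      mul_one, smul_eq_mul, Nat.cast_add, Nat.cast_one]
    exact ENNReal.inv_mul_cancel (by simp) (by simp)⟩⟩

end WeightedPotential

end

/-! Let `R` bound the diameter of `S = Kn n₀` and `W` bound `w` on `S`. Divided by `R * W ^ 2`, each
factor `|z - t| w(z) w(t)` lies in `[0, 1]`, and minus its logarithm is the kernel `log (R / |z -
t|) + q(z) + q(t)` with `q = log (W / w)`, lower semicontinuous with values in `[0, ∞]`. The
weighted energy changes only by the constant `log (R W²)`. Let `V` be the minimal normalized energy
on `K`, finite by nonpolarity.

A minimizer exists by weak compactness and lower semicontinuity. It is unique because the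
logarithmic kernel is strictly positive definite: by Frullani's integral it is a superposition of
Gaussian kernels (`two_mul_logInv_eq_lintegral`), and these are characteristic functions of Gaussian
measures (`gaussianEnergy_add_sub`).

Discrete and continuous energies are compared both ways. Averaging the pair energy of a
configuration over a product measure bounds the diameters below by `exp (-V) R W²`
(`logInv_weightedDiameter_le`). Conversely, if the normalized roots of the Vandermonde products stay
above `a`, weak limits of the counting measures have energy at most `log (1 / a)`
(`mutualEnergy_le_logInv`), since truncation of the kernel makes the diagonal negligible. So the
diameters converge to `exp (-V) R W²`. A cluster point for asymptotically optimal points of the `Kn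
n` is carried by every `Kn m`, hence by `K`, and has energy at most `V`: it is the equilibrium
measure. -/

noncomputable section

namespace WeightedPotential

open ProbabilityTheory ComplexConjugate

/-! ### The truncated logarithm -/

/-- `log (1 / x)`, truncated below at `0`, and equal to `∞` for `x ≤ 0`. -/
def logInv (x : ℝ) : ℝ≥0∞ := (ENNReal.log (ENNReal.ofReal x)⁻¹).toENNReal

lemma logInv_of_nonpos {x : ℝ} (hx : x ≤ 0) : logInv x = ∞ := by
  simp [logInv, ENNReal.ofReal_of_nonpos hx]

lemma logInv_of_pos {x : ℝ} (hx : 0 < x) : logInv x = ENNReal.ofReal (-Real.log x) := by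
  rw [logInv, ENNReal.log_inv, ENNReal.log_ofReal_of_pos hx, ← EReal.coe_neg,
    EReal.toENNReal_of_ne_top (EReal.coe_ne_top _), EReal.toReal_coe]

lemma logInv_ne_top_iff {x : ℝ} : logInv x ≠ ∞ ↔ 0 < x := by
  refine ⟨fun h => ?_, fun h => ?_⟩
  · by_contra hx
    exact h (logInv_of_nonpos (not_lt.1 hx))
  · rw [logInv_of_pos h]
    exact ENNReal.ofReal_ne_top

lemma continuous_logInv : Continuous logInv :=
  (ENNReal.continuous_log.comp (continuous_inv.comp ENNReal.continuous_ofReal)).ereal_toENNReal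

lemma antitone_logInv : Antitone logInv := fun _ _ h =>
  EReal.toENNReal_le_toENNReal
    (ENNReal.log_monotone (ENNReal.inv_le_inv.2 (ENNReal.ofReal_le_ofReal h)))

lemma logInv_one : logInv 1 = 0 := by
  simp [logInv_of_pos one_pos]

/-- With both factors in `[0, 1]` the truncation at `0` never acts; this is why all products are
normalized below. -/
lemma logInv_mul {x y : ℝ} (hx : 0 ≤ x) (hx1 : x ≤ 1) (hy : 0 ≤ y) (hy1 : y ≤ 1) :
    logInv (x * y) = logInv x + logInv y := by
  rcases hx.eq_or_lt with rfl | hx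
  · simp [logInv_of_nonpos]
  rcases hy.eq_or_lt with rfl | hy
  · simp [logInv_of_nonpos]
  rw [logInv_of_pos hx, logInv_of_pos hy, logInv_of_pos (mul_pos hx hy),
    ← ENNReal.ofReal_add (by simpa using Real.log_nonpos hx.le hx1)
      (by simpa using Real.log_nonpos hy.le hy1), Real.log_mul hx.ne' hy.ne']
  congr 1
  ring

lemma logInv_prod {ι : Type*} (s : Finset ι) (f : ι → ℝ) (h0 : ∀ i ∈ s, 0 ≤ f i)
    (h1 : ∀ i ∈ s, f i ≤ 1) : logInv (∏ i ∈ s, f i) = ∑ i ∈ s, logInv (f i) := by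
  classical
  induction s using Finset.induction_on with
  | empty => simp [logInv_one]
  | insert a s ha ih =>
    rw [Finset.prod_insert ha, Finset.sum_insert ha, ← ih
      (fun i hi => h0 i (Finset.mem_insert_of_mem hi))
      (fun i hi => h1 i (Finset.mem_insert_of_mem hi))]
    exact logInv_mul (h0 a (by simp)) (h1 a (by simp))
      (Finset.prod_nonneg fun i hi => h0 i (Finset.mem_insert_of_mem hi))
      (Finset.prod_le_one (fun i hi => h0 i (Finset.mem_insert_of_mem hi))
        (fun i hi => h1 i (Finset.mem_insert_of_mem hi)))

lemma logInv_pow {x : ℝ} (hx : 0 ≤ x) (hx1 : x ≤ 1) (n : ℕ) : logInv (x ^ n) = n * logInv x := by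
  have := logInv_prod (Finset.range n) (fun _ => x) (fun _ _ => hx) (fun _ _ => hx1)
  simpa using this

lemma logInv_exp_neg {x : ℝ} : logInv (Real.exp (-x)) = ENNReal.ofReal x := by
  rw [logInv_of_pos (Real.exp_pos _), Real.log_exp, neg_neg]

lemma logInv_lt_of_exp_neg_lt {a v : ℝ} (ha : a ≤ 1) (h : Real.exp (-v) < a) :
    logInv a < ENNReal.ofReal v := by
  have ha0 : 0 < a := (Real.exp_pos _).trans h
  have h1 := (Real.lt_log_iff_exp_lt ha0).2 h
  have h2 := Real.log_nonpos ha0.le ha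
  rw [logInv_of_pos ha0]
  exact (ENNReal.ofReal_lt_ofReal_iff (by linarith)).2 (by linarith)

lemma exp_neg_le_of_logInv_le {a : ℝ} {v : ℝ} (hv : 0 ≤ v)
    (h : logInv a ≤ ENNReal.ofReal v) : Real.exp (-v) ≤ a := by
  have ha : 0 < a := logInv_ne_top_iff.1 (ne_top_of_le_ne_top ENNReal.ofReal_ne_top h)
  rw [logInv_of_pos ha, ENNReal.ofReal_le_ofReal_iff hv] at h
  rw [← Real.le_log_iff_exp_le ha]; linarith

/-! ### Semicontinuity of integrals under weak convergence -/

lemma lintegral_eq_iSup_min {X : Type*} [MeasurableSpace X] (μ : Measure X)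
    {f : X → ℝ≥0∞} (hf : Measurable f) :
    ∫⁻ x, f x ∂μ = ⨆ M : ℕ, ∫⁻ x, min (f x) M ∂μ := by
  rw [← lintegral_iSup (fun M => hf.min measurable_const)
    (fun M N hMN x => min_le_min_left _ (by exact_mod_cast hMN))]
  congr with x
  rw [← inf_iSup_eq, ENNReal.iSup_natCast, inf_top_eq]

/-- Lower semicontinuity of integrals of lower semicontinuous functions under weak convergence. -/
lemma lintegral_le_liminf_of_tendsto {X : Type*} [TopologicalSpace X] [MeasurableSpace X]
    [BorelSpace X] [HasOuterApproxClosed X] {f : X → ℝ≥0∞} (hf : LowerSemicontinuous f)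
    {μ : ProbabilityMeasure X} {μs : ℕ → ProbabilityMeasure X} (h : Tendsto μs atTop (𝓝 μ)) :
    ∫⁻ x, f x ∂(μ : Measure X) ≤ atTop.liminf fun n => ∫⁻ x, f x ∂(μs n : Measure X) := by
  have trunc (M : ℕ) : ∫⁻ x, min (f x) M ∂(μ : Measure X) ≤
      atTop.liminf fun n => ∫⁻ x, min (f x) M ∂(μs n : Measure X) := by
    set g : X → ℝ := fun x => (min (f x) M).toReal with hg
    have hne (x : X) : min (f x) M ≠ ∞ := ((min_le_right _ _).trans_lt (by simp)).ne
    have hfg (x : X) : min (f x) M = ENNReal.ofReal (g x) := (ENNReal.ofReal_toReal (hne x)).symm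
    have hgm : Measurable g := (hf.measurable.min measurable_const).ennreal_toReal
    have hopen (t : ℝ) (ht : 0 < t) : IsOpen {x | t < g x} := by
      have : {x | t < g x} = {x | ENNReal.ofReal t < f x} ∩ {_x | ENNReal.ofReal t < M} := by
        ext x
        rw [Set.mem_inter_iff]
        change t < (min (f x) M).toReal ↔ ENNReal.ofReal t < f x ∧ ENNReal.ofReal t < M
        rw [← lt_min_iff, ENNReal.ofReal_lt_iff_lt_toReal ht.le (hne x)]
      rw [this]
      exact (hf.isOpen_preimage _).inter isOpen_const
    -- Layer cake reduces the claim to the open superlevel sets, where the portmanteau inequality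
    -- applies for each `t`; Fatou's lemma in `t` then moves the liminf outside.
    have layer (ν : Measure X) : ∫⁻ x, min (f x) M ∂ν = ∫⁻ t in Set.Ioi 0, ν {x | t < g x} := by
      rw [← lintegral_eq_lintegral_meas_lt ν
        (Eventually.of_forall fun x => (ENNReal.toReal_nonneg : 0 ≤ g x)) hgm.aemeasurable]
      exact lintegral_congr hfg
    simp_rw [layer]
    refine (setLIntegral_mono' measurableSet_Ioi fun t ht =>
      ProbabilityMeasure.le_liminf_measure_open_of_tendsto h (hopen t ht)).trans ?_
    exact lintegral_liminf_le fun n => Antitone.measurable fun s t hst =>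
      measure_mono fun ω hω => lt_of_le_of_lt hst hω
  rw [lintegral_eq_iSup_min _ hf.measurable]
  exact iSup_le fun M => (trunc M).trans
    (liminf_le_liminf (Eventually.of_forall fun n => lintegral_mono fun x => min_le_left _ _))

lemma lowerSemicontinuous_min_const {X : Type*} [TopologicalSpace X] {f : X → ℝ≥0∞}
    (hf : LowerSemicontinuous f) (M : ℝ≥0∞) : LowerSemicontinuous fun x => min (f x) M :=
  hf.inf lowerSemicontinuous_const

/-! ### Normalized energy of measures and of configurations -/

/-- The kernel `log (R / |z - t|) + q(z) + q(t)`, the logarithm being truncated below at `0`. -/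
def energyKernel (R : ℝ) (q : ℂ → ℝ≥0∞) (p : ℂ × ℂ) : ℝ≥0∞ :=
  logInv (‖p.1 - p.2‖ / R) + q p.1 + q p.2

/-- The mutual energy of two measures with respect to `energyKernel R q`. -/
def mutualEnergy (R : ℝ) (q : ℂ → ℝ≥0∞) (μ ν : Measure ℂ) : ℝ≥0∞ :=
  ∫⁻ p, energyKernel R q p ∂(μ.prod ν)

lemma lowerSemicontinuous_energyKernel (R : ℝ) {q : ℂ → ℝ≥0∞} (hq : LowerSemicontinuous q) :
    LowerSemicontinuous (energyKernel R q) := by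
  refine (LowerSemicontinuous.add ?_ (hq.comp continuous_fst)).add (hq.comp continuous_snd)
  exact (continuous_logInv.comp (by fun_prop)).lowerSemicontinuous

lemma energyKernel_symm (R : ℝ) (q : ℂ → ℝ≥0∞) (z t : ℂ) :
    energyKernel R q (z, t) = energyKernel R q (t, z) := by
  simp only [energyKernel, norm_sub_rev z t, add_right_comm]

lemma lintegral_countingMeasure_prod {n : ℕ} (z : Fin (n + 1) → ℂ) {f : ℂ × ℂ → ℝ≥0∞}
    (hf : Measurable f) :
    ∫⁻ p, f p ∂((countingMeasure z : Measure ℂ).prod (countingMeasure z : Measure ℂ)) =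
      ((n : ℝ≥0∞) + 1)⁻¹ * (((n : ℝ≥0∞) + 1)⁻¹ * ∑ i, ∑ j, f (z i, z j)) := by
  rw [lintegral_prod _ hf.aemeasurable]
  simp only [countingMeasure, ProbabilityMeasure.coe_mk, lintegral_smul_measure,
    lintegral_finsetSum_measure, lintegral_dirac, smul_eq_mul, Finset.mul_sum]

lemma sum_sum_eq_diag_add_pairs {n : ℕ} (f : Fin (n + 1) → Fin (n + 1) → ℝ≥0∞)
    (hf : ∀ i j, f i j = f j i) :
    ∑ i, ∑ j, f i j = ∑ i, f i i + 2 * ∑ i, ∑ j ∈ Finset.Ioi i, f i j := by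
  have h1 (i : Fin (n + 1)) : ∑ j, f i j =
      f i i + (∑ j ∈ Finset.Ioi i, f i j + ∑ j ∈ Finset.Iio i, f i j) := by
    have hd : Disjoint (Finset.Ioi i) (Finset.Iio i) := by
      rw [Finset.disjoint_left]; intro a; simp only [Finset.mem_Ioi, Finset.mem_Iio]; omega
    rw [← Finset.sum_union hd, ← Finset.sum_insert (by simp)]
    refine Finset.sum_congr ?_ fun _ _ => rfl
    ext j
    simp only [Finset.mem_univ, Finset.mem_insert, Finset.mem_union, Finset.mem_Ioi,
      Finset.mem_Iio, true_iff]
    omega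
  have h2 : ∑ i, ∑ j ∈ Finset.Iio i, f i j = ∑ i, ∑ j ∈ Finset.Ioi i, f i j := by
    rw [Finset.sum_comm' (t' := Finset.univ) (s' := fun j => Finset.Ioi j) (by simp)]
    exact Finset.sum_congr rfl fun i _ => Finset.sum_congr rfl fun j _ => hf j i
  simp_rw [h1, Finset.sum_add_distrib, h2, two_mul]

lemma sum_card_Ioi (n : ℕ) : ∑ i : Fin (n + 1), (Finset.Ioi i).card = (n + 1).choose 2 := by
  simp only [Fin.card_Ioi]
  rw [Fin.sum_univ_eq_sum_range (fun i => n + 1 - 1 - i) (n + 1),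
    Finset.sum_range_reflect (fun i => i), Finset.sum_range_id, Nat.choose_two_right]

/-- The kernel is infinite on the diagonal, but after truncation the `n + 1` diagonal terms, of
weight `1 / (n + 1)²`, contribute at most `M / (n + 1)`. Each unordered pair has weight `2 / (n +
1)²`, at most the inverse of the number of pairs. -/
lemma lintegral_min_energyKernel_countingMeasure_le (R : ℝ) {q : ℂ → ℝ≥0∞}
    (hq : LowerSemicontinuous q) (M : ℝ≥0∞) {n : ℕ} (z : Fin (n + 1) → ℂ) :
    ∫⁻ p, min (energyKernel R q p) M
        ∂((countingMeasure z : Measure ℂ).prod (countingMeasure z : Measure ℂ)) ≤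
      ((n : ℝ≥0∞) + 1)⁻¹ * M + (((n + 1).choose 2 : ℕ) : ℝ≥0∞)⁻¹ *
        ∑ i, ∑ j ∈ Finset.Ioi i, energyKernel R q (z i, z j) := by
  have hmeas := (lowerSemicontinuous_energyKernel R hq).measurable.min
    (measurable_const (a := M))
  rw [lintegral_countingMeasure_prod z hmeas, sum_sum_eq_diag_add_pairs
    (fun i j => min (energyKernel R q (z i, z j)) M)
    (fun i j => by simp only [energyKernel_symm R q (z i) (z j)])]
  set a : ℝ≥0∞ := (n : ℝ≥0∞) + 1 with ha
  have ha0 : a ≠ 0 := by simp [ha]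
  have hat : a ≠ ∞ := by simp [ha]
  set S := ∑ i, ∑ j ∈ Finset.Ioi i, energyKernel R q (z i, z j)
  have hdiag : ∑ i, min (energyKernel R q (z i, z i)) M ≤ a * M := by
    refine (Finset.sum_le_sum fun i _ => min_le_right _ _).trans ?_
    simp [ha]
  have hpairs : ∑ i, ∑ j ∈ Finset.Ioi i, min (energyKernel R q (z i, z j)) M ≤ S :=
    Finset.sum_le_sum fun i _ => Finset.sum_le_sum fun j _ => min_le_left _ _
  have hcoef : a⁻¹ * (a⁻¹ * 2) ≤ (((n + 1).choose 2 : ℕ) : ℝ≥0∞)⁻¹ := by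
    rw [ENNReal.le_inv_iff_mul_le]
    have h2 : 2 * (((n + 1).choose 2 : ℕ) : ℝ≥0∞) ≤ a * a := by
      have : 2 * (n + 1).choose 2 ≤ (n + 1) * (n + 1) := by
        rw [Nat.choose_two_right]
        have := Nat.mul_div_le ((n + 1) * (n + 1 - 1)) 2
        have h3 : (n + 1) * (n + 1 - 1) ≤ (n + 1) * (n + 1) := Nat.mul_le_mul_left _ (by omega)
        omega
      rw [ha]
      exact_mod_cast this
    calc a⁻¹ * (a⁻¹ * 2) * (((n + 1).choose 2 : ℕ) : ℝ≥0∞)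
        = a⁻¹ * (a⁻¹ * (2 * (((n + 1).choose 2 : ℕ) : ℝ≥0∞))) := by ring
      _ ≤ a⁻¹ * (a⁻¹ * (a * a)) := by gcongr
      _ = 1 := by
        rw [← mul_assoc a⁻¹ a a, ENNReal.inv_mul_cancel ha0 hat, one_mul,
          ENNReal.inv_mul_cancel ha0 hat]
  calc a⁻¹ * (a⁻¹ * (∑ i, min (energyKernel R q (z i, z i)) M +
        2 * ∑ i, ∑ j ∈ Finset.Ioi i, min (energyKernel R q (z i, z j)) M))
      ≤ a⁻¹ * (a⁻¹ * (a * M + 2 * S)) := by gcongr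
    _ = a⁻¹ * ((a⁻¹ * a) * M) + a⁻¹ * (a⁻¹ * 2) * S := by ring
    _ ≤ _ := by
        rw [ENNReal.inv_mul_cancel ha0 hat, one_mul]
        gcongr

/-- Each index belongs to exactly `n` pairs, whence the exponent `n` on the weights. -/
lemma prod_pairs_mul {n : ℕ} (a : Fin (n + 1) → ℝ) :
    ∏ i, ∏ j ∈ Finset.Ioi i, (a i * a j) = ∏ j, a j ^ n := by
  simp_rw [Finset.prod_mul_distrib]
  rw [Finset.prod_comm' (t' := Finset.univ) (s' := fun j => Finset.Iio j) (by simp)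
    (f := fun _ j => a j),
    ← Finset.prod_mul_distrib]
  refine Finset.prod_congr rfl fun i _ => ?_
  rw [Finset.prod_const, Finset.prod_const, ← pow_add, Fin.card_Ioi, Fin.card_Iio]
  congr 1
  omega

lemma prod_pairs_const (n : ℕ) (c : ℝ) :
    ∏ i : Fin (n + 1), ∏ _j ∈ Finset.Ioi i, c = c ^ (n + 1).choose 2 := by
  simp_rw [Finset.prod_const]
  rw [Finset.prod_pow_eq_pow_sum, sum_card_Ioi]

lemma weightedVDM_eq_prod (w : ℂ → ℝ) {n : ℕ} (z : Fin (n + 1) → ℂ) :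
    weightedVDM w n z = ∏ i, ∏ j ∈ Finset.Ioi i, (‖z i - z j‖ * (w (z i) * w (z j))) := by
  have h (i) : ∏ j ∈ Finset.Ioi i, (‖z i - z j‖ * (w (z i) * w (z j))) =
      (∏ j ∈ Finset.Ioi i, ‖z i - z j‖) * ∏ j ∈ Finset.Ioi i, (w (z i) * w (z j)) :=
    Finset.prod_mul_distrib
  simp_rw [h]
  rw [Finset.prod_mul_distrib, weightedVDM, Matrix.det_vandermonde,
    prod_pairs_mul (fun j => w (z j)), norm_prod]
  simp_rw [norm_prod, norm_sub_rev]

lemma logInv_weightedVDM {w : ℂ → ℝ} {q : ℂ → ℝ≥0∞} {R W : ℝ} (hR : 0 < R) (hW : 0 < W) {n : ℕ}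
    {z : Fin (n + 1) → ℂ} (hz : ∀ i j, ‖z i - z j‖ ≤ R) (hw0 : ∀ i, 0 ≤ w (z i))
    (hw1 : ∀ i, w (z i) ≤ W) (hq : ∀ i, q (z i) = logInv (w (z i) / W)) :
    logInv (weightedVDM w n z / (R * W ^ 2) ^ (n + 1).choose 2) =
      ∑ i, ∑ j ∈ Finset.Ioi i, energyKernel R q (z i, z j) := by
  have hn (i j) : 0 ≤ ‖z i - z j‖ / R := by positivity
  have hn1 (i j) : ‖z i - z j‖ / R ≤ 1 := (div_le_one hR).2 (hz i j)
  have hu (i) : 0 ≤ w (z i) / W := div_nonneg (hw0 i) hW.le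
  have hu1 (i) : w (z i) / W ≤ 1 := (div_le_one hW).2 (hw1 i)
  have hf0 (i j) : 0 ≤ ‖z i - z j‖ / R * (w (z i) / W * (w (z j) / W)) :=
    mul_nonneg (hn i j) (mul_nonneg (hu i) (hu j))
  have hf1 (i j) : ‖z i - z j‖ / R * (w (z i) / W * (w (z j) / W)) ≤ 1 :=
    mul_le_one₀ (hn1 i j) (mul_nonneg (hu i) (hu j)) (mul_le_one₀ (hu1 i) (hu j) (hu1 j))
  have hprod : weightedVDM w n z / (R * W ^ 2) ^ (n + 1).choose 2 =
      ∏ i, ∏ j ∈ Finset.Ioi i, (‖z i - z j‖ / R * (w (z i) / W * (w (z j) / W))) := by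
    rw [← prod_pairs_const, weightedVDM_eq_prod, ← Finset.prod_div_distrib]
    refine Finset.prod_congr rfl fun i _ => ?_
    rw [← Finset.prod_div_distrib]
    refine Finset.prod_congr rfl fun j _ => ?_
    field_simp
  rw [hprod, logInv_prod _ _ (fun i _ => Finset.prod_nonneg fun j _ => hf0 i j)
    (fun i _ => Finset.prod_le_one (fun j _ => hf0 i j) (fun j _ => hf1 i j))]
  refine Finset.sum_congr rfl fun i _ => ?_
  rw [logInv_prod _ _ (fun j _ => hf0 i j) (fun j _ => hf1 i j)]
  refine Finset.sum_congr rfl fun j _ => ?_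
  rw [logInv_mul (hn i j) (hn1 i j) (mul_nonneg (hu i) (hu j))
    (mul_le_one₀ (hu1 i) (hu j) (hu1 j)), logInv_mul (hu i) (hu1 i) (hu j) (hu1 j),
    energyKernel, hq, hq, add_assoc]

/-! ### Averaging over independent random points -/

lemma map_pi_pair {n : ℕ} (τ : Measure ℂ) [IsProbabilityMeasure τ] {i j : Fin (n + 1)}
    (hij : i ≠ j) :
    (Measure.pi fun _ : Fin (n + 1) => τ).map (fun z => (z i, z j)) = τ.prod τ := by
  have hind : ProbabilityTheory.iIndepFun (fun (i : Fin (n + 1)) (z : Fin (n + 1) → ℂ) => z i)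
      (Measure.pi fun _ : Fin (n + 1) => τ) :=
    ProbabilityTheory.iIndepFun_pi (X := fun _ x => x) (fun _ => aemeasurable_id)
  have h := (ProbabilityTheory.indepFun_iff_map_prod_eq_prod_map_map
    (measurable_pi_apply i).aemeasurable (measurable_pi_apply j).aemeasurable).1
    (hind.indepFun hij)
  rw [h, (measurePreserving_eval (fun _ : Fin (n + 1) => τ) i).map_eq,
    (measurePreserving_eval (fun _ : Fin (n + 1) => τ) j).map_eq]

lemma lintegral_pi_sum_pairs {n : ℕ} (τ : Measure ℂ) [IsProbabilityMeasure τ]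
    {f : ℂ × ℂ → ℝ≥0∞} (hf : Measurable f) :
    ∫⁻ z, ∑ i, ∑ j ∈ Finset.Ioi i, f (z i, z j) ∂(Measure.pi fun _ : Fin (n + 1) => τ) =
      ((n + 1).choose 2 : ℕ) * ∫⁻ p, f p ∂(τ.prod τ) := by
  have hm (i j : Fin (n + 1)) : Measurable fun z : Fin (n + 1) → ℂ => (z i, z j) :=
    (measurable_pi_apply i).prodMk (measurable_pi_apply j)
  have hfm (i j : Fin (n + 1)) : Measurable fun z : Fin (n + 1) → ℂ => f (z i, z j) :=
    hf.comp (hm i j)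
  rw [lintegral_finsetSum _ fun i _ => Finset.measurable_sum _ fun j _ => hfm i j]
  rw [← sum_card_Ioi, Nat.cast_sum, Finset.sum_mul]
  refine Finset.sum_congr rfl fun i _ => ?_
  rw [lintegral_finsetSum _ fun j _ => hfm i j, ← nsmul_eq_mul, ← Finset.sum_const]
  refine Finset.sum_congr rfl fun j hj => ?_
  rw [← map_pi_pair τ (Finset.mem_Ioi.1 hj).ne, lintegral_map hf (hm i j)]

/-- If all configurations in a set carrying `τ` have pair energy at least `c`, then so does `τ`,
up to the number of pairs. -/
lemma le_choose_mul_mutualEnergy (R : ℝ) {q : ℂ → ℝ≥0∞} (hq : LowerSemicontinuous q) {K : Set ℂ}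
    (τ : Measure ℂ) [IsProbabilityMeasure τ] (hτ : τ Kᶜ = 0) (n : ℕ) {c : ℝ≥0∞}
    (hc : ∀ z : Fin (n + 1) → ℂ, (∀ i, z i ∈ K) →
      c ≤ ∑ i, ∑ j ∈ Finset.Ioi i, energyKernel R q (z i, z j)) :
    c ≤ ((n + 1).choose 2 : ℕ) * mutualEnergy R q τ τ := by
  rw [mutualEnergy, ← lintegral_pi_sum_pairs τ (lowerSemicontinuous_energyKernel R hq).measurable]
  have hK : ∀ᵐ z ∂(Measure.pi fun _ : Fin (n + 1) => τ), ∀ i, z i ∈ K := by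
    rw [ae_all_iff]
    exact fun i => (measurePreserving_eval (fun _ : Fin (n + 1) => τ) i).quasiMeasurePreserving.ae
      (p := fun x => x ∈ K) hτ
  calc c = ∫⁻ _, c ∂(Measure.pi fun _ : Fin (n + 1) => τ) := by simp
    _ ≤ _ := lintegral_mono_ae (hK.mono fun z hz => hc z hz)

/-! ### Strict positive definiteness of the Gaussian kernel -/

/-- The mutual energy of two measures on the plane for the Gaussian kernel of parameter `s`. -/
def gaussianEnergy (s : ℝ) (μ ν : Measure ℂ) : ℝ :=
  ∫ p : ℂ × ℂ, Real.exp (-(s * ‖p.1 - p.2‖ ^ 2 / 2)) ∂(μ.prod ν)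

instance isOpenPosMeasure_gaussianReal : (gaussianReal 0 1).IsOpenPosMeasure :=
  (gaussianReal_absolutelyContinuous' 0 one_ne_zero).isOpenPosMeasure

instance isOpenPosMeasure_stdGaussian : (stdGaussian ℂ).IsOpenPosMeasure := by
  refine Continuous.isOpenPosMeasure_map (by fun_prop) fun z =>
    ⟨fun i => (stdOrthonormalBasis ℝ ℂ).repr z i, ?_⟩
  exact (stdOrthonormalBasis ℝ ℂ).sum_repr z

/-- The centered Gaussian measure on the plane whose covariance is `s` times the identity. -/
def scaledGaussian (s : ℝ) : Measure ℂ := (stdGaussian ℂ).map fun z => √s • z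

instance isProbabilityMeasure_scaledGaussian (s : ℝ) : IsProbabilityMeasure (scaledGaussian s) :=
  Measure.isProbabilityMeasure_map (by fun_prop)

lemma isOpenPosMeasure_scaledGaussian {s : ℝ} (hs : 0 < s) : (scaledGaussian s).IsOpenPosMeasure :=
  Continuous.isOpenPosMeasure_map (by fun_prop)
    fun z => ⟨(√s)⁻¹ • z, smul_inv_smul₀ (Real.sqrt_pos.2 hs).ne' z⟩

lemma charFun_scaledGaussian {s : ℝ} (hs : 0 ≤ s) (z : ℂ) :
    charFun (scaledGaussian s) z = (Real.exp (-(s * ‖z‖ ^ 2 / 2)) : ℝ) := by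
  have : charFun (scaledGaussian s) z = charFun (stdGaussian ℂ) (√s • z) :=
    charFun_map_smul _ _
  rw [this, charFun_stdGaussian, norm_smul, Real.norm_of_nonneg (Real.sqrt_nonneg s),
    Complex.ofReal_mul, mul_pow, ← Complex.ofReal_pow, Real.sq_sqrt hs]
  push_cast
  congr 1
  ring

/-- Fubini: the character at `p.1 - p.2` splits into a product of a character and a conjugate one.
-/
lemma integral_charFun_sub (μ ν γ : Measure ℂ) [IsProbabilityMeasure μ] [IsProbabilityMeasure ν]
    [IsProbabilityMeasure γ] :
    ∫ p : ℂ × ℂ, charFun γ (p.1 - p.2) ∂(μ.prod ν) =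
      ∫ ξ, charFun μ ξ * conj (charFun ν ξ) ∂γ := by
  simp_rw [charFun_apply (μ := γ)]
  rw [integral_integral_swap]
  · refine integral_congr_ae (Eventually.of_forall fun ξ => ?_)
    simp only
    rw [charFun_apply, ← charFun_neg, charFun_apply, ← integral_prod_mul]
    refine integral_congr_ae (Eventually.of_forall fun p => ?_)
    simp only
    rw [← Complex.exp_add, inner_sub_right, inner_neg_right, real_inner_comm p.1,
      real_inner_comm p.2]
    push_cast
    congr 1
    ring
  · refine Integrable.of_bound (C := 1) (by
      refine Continuous.aestronglyMeasurable ?_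
      fun_prop) (Eventually.of_forall fun p => ?_)
    exact (Complex.norm_exp_ofReal_mul_I _).le

lemma gaussianEnergy_eq {s : ℝ} (hs : 0 ≤ s) (μ ν : Measure ℂ) [IsProbabilityMeasure μ]
    [IsProbabilityMeasure ν] :
    (gaussianEnergy s μ ν : ℂ) = ∫ ξ, charFun μ ξ * conj (charFun ν ξ) ∂(scaledGaussian s) := by
  rw [← integral_charFun_sub, gaussianEnergy, ← integral_complex_ofReal]
  simp_rw [charFun_scaledGaussian hs]

lemma gaussianEnergy_comm (s : ℝ) (μ ν : Measure ℂ) [SFinite μ]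
    [SFinite ν] : gaussianEnergy s μ ν = gaussianEnergy s ν μ := by
  rw [gaussianEnergy, gaussianEnergy, ← integral_prod_swap]
  simp [norm_sub_rev]

/-- By the Fourier representation the quadratic form at `μ - ν` is a squared `L²` norm, hence
nonnegative. -/
lemma gaussianEnergy_add_sub {s : ℝ} (hs : 0 ≤ s) (μ ν : Measure ℂ) [IsProbabilityMeasure μ]
    [IsProbabilityMeasure ν] :
    gaussianEnergy s μ μ + gaussianEnergy s ν ν - 2 * gaussianEnergy s μ ν =
      ∫ ξ, ‖charFun μ ξ - charFun ν ξ‖ ^ 2 ∂(scaledGaussian s) := by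
  have hint (μ ν : Measure ℂ) [IsProbabilityMeasure μ] [IsProbabilityMeasure ν] :
      Integrable (fun ξ => charFun μ ξ * conj (charFun ν ξ)) (scaledGaussian s) := by
    refine Integrable.of_bound (C := 1) ?_ (Eventually.of_forall fun ξ => ?_)
    · exact (measurable_charFun.mul
        (Complex.continuous_conj.measurable.comp measurable_charFun)).aestronglyMeasurable
    · rw [norm_mul, RCLike.norm_conj]
      exact mul_le_one₀ (norm_charFun_le_one _) (norm_nonneg _) (norm_charFun_le_one _)
  have i1 (μ ν μ' ν' : Measure ℂ) [IsProbabilityMeasure μ] [IsProbabilityMeasure ν]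
      [IsProbabilityMeasure μ'] [IsProbabilityMeasure ν'] :
      Integrable (fun ξ => charFun μ ξ * conj (charFun μ' ξ) + charFun ν ξ * conj (charFun ν' ξ))
        (scaledGaussian s) := (hint μ μ').add (hint ν ν')
  have h : ((gaussianEnergy s μ μ + gaussianEnergy s ν ν - 2 * gaussianEnergy s μ ν : ℝ) : ℂ) =
      ((∫ ξ, ‖charFun μ ξ - charFun ν ξ‖ ^ 2 ∂(scaledGaussian s) : ℝ) : ℂ) := by
    have h2 : 2 * gaussianEnergy s μ ν = gaussianEnergy s μ ν + gaussianEnergy s ν μ := by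
      rw [gaussianEnergy_comm s ν μ, two_mul]
    rw [h2, ← integral_complex_ofReal]
    push_cast
    rw [gaussianEnergy_eq hs, gaussianEnergy_eq hs, gaussianEnergy_eq hs, gaussianEnergy_eq hs,
      ← integral_add (hint μ μ) (hint ν ν), ← integral_add (hint μ ν) (hint ν μ),
      ← integral_sub (i1 μ ν μ ν) (i1 μ ν ν μ)]
    refine integral_congr_ae (Eventually.of_forall fun ξ => ?_)
    simp only [← Complex.mul_conj', map_sub]
    ring
  exact_mod_cast h

lemma two_mul_gaussianEnergy_le {s : ℝ} (hs : 0 ≤ s) (μ ν : Measure ℂ) [IsProbabilityMeasure μ]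
    [IsProbabilityMeasure ν] :
    2 * gaussianEnergy s μ ν ≤ gaussianEnergy s μ μ + gaussianEnergy s ν ν := by
  have := gaussianEnergy_add_sub hs μ ν
  have h2 : 0 ≤ ∫ ξ, ‖charFun μ ξ - charFun ν ξ‖ ^ 2 ∂(scaledGaussian s) :=
    integral_nonneg fun _ => by positivity
  linarith

/-- The Gaussian kernel is strictly positive definite. -/
lemma eq_of_two_mul_gaussianEnergy_eq {s : ℝ} (hs : 0 < s) {μ ν : Measure ℂ}
    [IsProbabilityMeasure μ] [IsProbabilityMeasure ν]
    (h : 2 * gaussianEnergy s μ ν = gaussianEnergy s μ μ + gaussianEnergy s ν ν) : μ = ν := by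
  have h1 := gaussianEnergy_add_sub hs.le μ ν
  rw [h, sub_self, eq_comm, integral_eq_zero_iff_of_nonneg (fun _ => by positivity)] at h1
  -- The Gaussian measure charges every nonempty open set, so the continuous characteristic
  -- functions, equal almost everywhere, are equal everywhere.
  · have := isOpenPosMeasure_scaledGaussian hs
    refine Measure.ext_of_charFun ?_
    have h2 := (Continuous.ae_eq_iff_eq (μ := scaledGaussian s)
      ((continuous_charFun.sub continuous_charFun).norm.pow 2) continuous_const).1 h1
    funext ξ
    have h3 : ‖charFun μ ξ - charFun ν ξ‖ ^ 2 = 0 := congrFun h2 ξ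
    simpa [sub_eq_zero] using h3
  · refine Integrable.of_bound (C := 2 ^ 2) ?_ (Eventually.of_forall fun ξ => ?_)
    · exact ((continuous_charFun.sub continuous_charFun).norm.pow 2).aestronglyMeasurable
    · rw [norm_pow, norm_norm]
      refine pow_le_pow_left₀ (norm_nonneg _) ((norm_sub_le _ _).trans ?_) 2
      linarith [norm_charFun_le_one (μ := μ) ξ, norm_charFun_le_one (μ := ν) ξ]

/-! ### The logarithm as a superposition of Gaussians -/

/-- A case of Frullani's integral, for the Lebesgue integral with values in `[0, ∞]`. -/
lemma lintegral_exp_neg_sub_exp_neg_div {a b : ℝ} (ha : 0 < a) (hab : a ≤ b) :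
    ∫⁻ s in Set.Ioi (0 : ℝ), ENNReal.ofReal ((Real.exp (-(s * a)) - Real.exp (-(s * b))) / s) =
      ENNReal.ofReal (Real.log (b / a)) := by
  -- The integrand is the integral of `exp (-(s * x))` over `x` in `(a, b]`; Tonelli then leaves the
  -- integral of `1 / x`.
  have h1 : ∀ s ∈ Set.Ioi (0 : ℝ),
      ENNReal.ofReal ((Real.exp (-(s * a)) - Real.exp (-(s * b))) / s) =
        ∫⁻ x in Set.Ioc a b, ENNReal.ofReal (Real.exp (-(s * x))) := by
    intro s hs
    have hs : 0 < s := hs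
    rw [← ofReal_integral_eq_lintegral_ofReal
      ((Continuous.integrableOn_Icc (by fun_prop)).mono_set Set.Ioc_subset_Icc_self)
      (Eventually.of_forall fun _ => (Real.exp_pos _).le),
      ← intervalIntegral.integral_of_le hab]
    congr 1
    rw [intervalIntegral.integral_eq_sub_of_hasDerivAt
      (f := fun x => -(Real.exp (-(s * x)) / s)) (fun x _ => ?_)
      (Continuous.intervalIntegrable (by fun_prop) _ _)]
    · ring
    · have := ((((hasDerivAt_id x).const_mul s).neg).exp.div_const s).neg
      convert! this using 1
      simp only [id]
      field_simp
      rfl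
  have h2 : ∀ x ∈ Set.Ioc a b,
      ∫⁻ s in Set.Ioi (0 : ℝ), ENNReal.ofReal (Real.exp (-(s * x))) = ENNReal.ofReal (1 / x) := by
    intro x hx
    have hx0 : 0 < x := ha.trans hx.1
    have hi := integrableOn_exp_mul_Ioi (a := -x) (by linarith) 0
    have hv := integral_exp_mul_Ioi (a := -x) (by linarith) 0
    rw [← ofReal_integral_eq_lintegral_ofReal ?_
      (Eventually.of_forall fun _ => (Real.exp_pos _).le)]
    · congr 1
      convert hv using 1
      · refine integral_congr_ae (Eventually.of_forall fun s => ?_)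
        simp only
        congr 1
        ring
      · simp [neg_div_neg_eq]
    · refine hi.congr (Eventually.of_forall fun s => ?_)
      simp only
      congr 1
      ring
  rw [setLIntegral_congr_fun measurableSet_Ioi h1, lintegral_lintegral_swap (by fun_prop),
    setLIntegral_congr_fun measurableSet_Ioc h2]
  have hii : IntervalIntegrable (fun x : ℝ => 1 / x) volume a b := by
    refine intervalIntegral.intervalIntegrable_one_div (fun x hx => ?_) continuousOn_id
    rw [Set.uIcc_of_le hab] at hx
    exact (ha.trans_le hx.1).ne'
  rw [← ofReal_integral_eq_lintegral_ofReal
    ((intervalIntegrable_iff_integrableOn_Ioc_of_le hab).1 hii)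
    ((ae_restrict_mem measurableSet_Ioc).mono fun x hx => by
      have : 0 < x := ha.trans hx.1
      change 0 ≤ 1 / x
      positivity), ← intervalIntegral.integral_of_le hab,
    integral_one_div_of_pos ha (ha.trans_le hab)]

/-- The logarithmic kernel is a superposition of Gaussian kernels. -/
lemma two_mul_logInv_eq_lintegral {r R : ℝ} (hR : 0 < R) (hr : 0 ≤ r) (hrR : r ≤ R) :
    2 * logInv (r / R) = ∫⁻ s in Set.Ioi (0 : ℝ),
      ENNReal.ofReal ((Real.exp (-(s * r ^ 2 / 2)) - Real.exp (-(s * R ^ 2 / 2))) / s) := by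
  have key {x : ℝ} (hx : 0 < x) (hxR : x ≤ R) : 2 * logInv (x / R) = ∫⁻ s in Set.Ioi (0 : ℝ),
      ENNReal.ofReal ((Real.exp (-(s * x ^ 2 / 2)) - Real.exp (-(s * R ^ 2 / 2))) / s) := by
    simp_rw [mul_div_assoc]
    rw [lintegral_exp_neg_sub_exp_neg_div (by positivity) (by gcongr),
      logInv_of_pos (by positivity), ← ENNReal.ofReal_ofNat 2, ← ENNReal.ofReal_mul (by norm_num)]
    congr 1
    rw [div_div_div_cancel_right₀ (by norm_num), ← div_pow, Real.log_pow, ← Real.log_inv, inv_div]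
    norm_num
  rcases hr.eq_or_lt with rfl | hr
  -- At `r = 0` both sides are infinite: the right side dominates its values at all small `x > 0`,
  -- and these tend to `∞`.
  · rw [zero_div, logInv_of_nonpos le_rfl, ENNReal.mul_top (by norm_num), eq_comm, eq_top_iff]
    have hlim : Tendsto (fun x : ℝ => 2 * logInv (x / R)) (𝓝[>] 0) (𝓝 ∞) := by
      have h1 : Tendsto (fun x : ℝ => logInv (x / R)) (𝓝[>] 0) (𝓝 ∞) := by
        have : Continuous fun x : ℝ => logInv (x / R) := continuous_logInv.comp (by fun_prop)
        have h := this.tendsto 0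
        rw [zero_div, logInv_of_nonpos le_rfl] at h
        exact h.mono_left nhdsWithin_le_nhds
      have h2 := ENNReal.Tendsto.const_mul (a := 2) h1 (Or.inl ENNReal.top_ne_zero)
      rwa [ENNReal.mul_top (by norm_num)] at h2
    refine le_of_tendsto hlim ?_
    filter_upwards [Ioc_mem_nhdsGT hR] with x hx
    rw [key hx.1 hx.2]
    refine setLIntegral_mono' measurableSet_Ioi fun s hs => ?_
    have hs : 0 < s := hs
    refine ENNReal.ofReal_le_ofReal ?_
    gcongr
    exact hx.1.le
  · exact key hr hrR

/-! ### Strict positive definiteness of the logarithmic energy -/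

lemma lowerSemicontinuous_zero : LowerSemicontinuous (0 : ℂ → ℝ≥0∞) := lowerSemicontinuous_const

/-- The field enters additively, so it cancels when `E(μ, μ) + E(ν, ν)` is compared with `2 E(μ,
ν)`. -/
lemma mutualEnergy_eq_add (R : ℝ) {q : ℂ → ℝ≥0∞} (hq : Measurable q) (μ ν : Measure ℂ)
    [IsProbabilityMeasure μ] [IsProbabilityMeasure ν] :
    mutualEnergy R q μ ν = mutualEnergy R 0 μ ν + ∫⁻ z, q z ∂μ + ∫⁻ z, q z ∂ν := by
  have h (p : ℂ × ℂ) : energyKernel R q p = energyKernel R 0 p + q p.1 + q p.2 := by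
    simp [energyKernel]
  have hm := (lowerSemicontinuous_energyKernel R lowerSemicontinuous_zero).measurable
  simp_rw [mutualEnergy, h]
  rw [lintegral_add_right _ (by fun_prop), lintegral_add_right _ (by fun_prop)]
  have h1 : ∫⁻ p, q p.1 ∂(μ.prod ν) = ∫⁻ z, q z ∂μ := by
    rw [← lintegral_map hq measurable_fst, Measure.map_fst_prod]
    simp
  have h2 : ∫⁻ p, q p.2 ∂(μ.prod ν) = ∫⁻ z, q z ∂ν := by
    rw [← lintegral_map hq measurable_snd, Measure.map_snd_prod]
    simp
  rw [h1, h2]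

lemma mutualEnergy_comm (R : ℝ) {q : ℂ → ℝ≥0∞} (hq : LowerSemicontinuous q) (μ ν : Measure ℂ)
    [SFinite μ] [SFinite ν] : mutualEnergy R q μ ν = mutualEnergy R q ν μ := by
  have hm := (lowerSemicontinuous_energyKernel R hq).measurable
  rw [mutualEnergy, mutualEnergy, ← Measure.prod_swap, lintegral_map hm measurable_swap]
  exact lintegral_congr fun p => energyKernel_symm R q p.2 p.1

lemma ae_prod_mem {S : Set ℂ} {μ ν : Measure ℂ} [SFinite μ] [SFinite ν] (hμ : μ Sᶜ = 0)
    (hν : ν Sᶜ = 0) : ∀ᵐ p ∂(μ.prod ν), p.1 ∈ S ∧ p.2 ∈ S := by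
  have h1 : ∀ᵐ p ∂(μ.prod ν), p.1 ∈ S :=
    Measure.quasiMeasurePreserving_fst.ae (p := fun x => x ∈ S) hμ
  have h2 : ∀ᵐ p ∂(μ.prod ν), p.2 ∈ S :=
    Measure.quasiMeasurePreserving_snd.ae (p := fun x => x ∈ S) hν
  exact h1.and h2

/-- The part of parameter `s` in the decomposition of the logarithmic energy into Gaussian
energies. -/
def energyDensity (R : ℝ) (μ ν : Measure ℂ) (s : ℝ) : ℝ≥0∞ :=
  ENNReal.ofReal ((gaussianEnergy s μ ν - Real.exp (-(s * R ^ 2 / 2))) / s)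

section

variable {S : Set ℂ} {R : ℝ} {μ ν : Measure ℂ} [IsProbabilityMeasure μ] [IsProbabilityMeasure ν]

lemma integrable_gaussian {s : ℝ} (hs : 0 < s) :
    Integrable (fun p : ℂ × ℂ => Real.exp (-(s * ‖p.1 - p.2‖ ^ 2 / 2))) (μ.prod ν) := by
  refine Integrable.of_bound (C := 1) (Continuous.aestronglyMeasurable (by fun_prop))
    (Eventually.of_forall fun p => ?_)
  rw [Real.norm_of_nonneg (Real.exp_pos _).le, Real.exp_le_one_iff]
  have : 0 ≤ s * ‖p.1 - p.2‖ ^ 2 / 2 := by positivity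
  linarith

/-- The bound `R` on the diameter makes the Gaussian difference nonnegative, so `ENNReal.ofReal`
loses nothing. -/
lemma energyDensity_eq_lintegral (hS : ∀ z ∈ S, ∀ t ∈ S, ‖z - t‖ ≤ R)
    (hμ : μ Sᶜ = 0) (hν : ν Sᶜ = 0) {s : ℝ} (hs : 0 < s) :
    0 ≤ gaussianEnergy s μ ν - Real.exp (-(s * R ^ 2 / 2)) ∧
    energyDensity R μ ν s = ∫⁻ p, ENNReal.ofReal ((Real.exp (-(s * ‖p.1 - p.2‖ ^ 2 / 2)) -
      Real.exp (-(s * R ^ 2 / 2))) / s) ∂(μ.prod ν) := by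
  have hi := integrable_gaussian (μ := μ) (ν := ν) hs
  have hnn : ∀ᵐ p ∂(μ.prod ν),
      0 ≤ Real.exp (-(s * ‖p.1 - p.2‖ ^ 2 / 2)) - Real.exp (-(s * R ^ 2 / 2)) := by
    filter_upwards [ae_prod_mem hμ hν] with p hp
    have := hS _ hp.1 _ hp.2
    rw [sub_nonneg]
    gcongr
  have he : gaussianEnergy s μ ν - Real.exp (-(s * R ^ 2 / 2)) =
      ∫ p, (Real.exp (-(s * ‖p.1 - p.2‖ ^ 2 / 2)) - Real.exp (-(s * R ^ 2 / 2))) ∂(μ.prod ν) := by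
    rw [integral_sub hi (integrable_const _), gaussianEnergy]
    simp
  refine ⟨he ▸ integral_nonneg_of_ae hnn, ?_⟩
  rw [energyDensity, he, ← integral_div]
  exact ofReal_integral_eq_lintegral_ofReal
    ((hi.sub (integrable_const _)).div_const s) (hnn.mono fun p hp => div_nonneg hp hs.le)

lemma measurable_energyKernel_density (R : ℝ) : Measurable fun x : (ℂ × ℂ) × ℝ =>
    ENNReal.ofReal ((Real.exp (-(x.2 * ‖x.1.1 - x.1.2‖ ^ 2 / 2)) -
      Real.exp (-(x.2 * R ^ 2 / 2))) / x.2) := by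
  fun_prop

lemma two_mul_mutualEnergy_zero (hR : 0 < R) (hS : ∀ z ∈ S, ∀ t ∈ S, ‖z - t‖ ≤ R)
    (hμ : μ Sᶜ = 0) (hν : ν Sᶜ = 0) :
    2 * mutualEnergy R 0 μ ν = ∫⁻ s in Set.Ioi (0 : ℝ), energyDensity R μ ν s := by
  have hm := (lowerSemicontinuous_energyKernel R lowerSemicontinuous_zero).measurable
  rw [mutualEnergy, ← lintegral_const_mul _ hm]
  have h1 : ∀ᵐ p ∂(μ.prod ν), 2 * energyKernel R 0 p = ∫⁻ s in Set.Ioi (0 : ℝ),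
      ENNReal.ofReal ((Real.exp (-(s * ‖p.1 - p.2‖ ^ 2 / 2)) -
        Real.exp (-(s * R ^ 2 / 2))) / s) := by
    filter_upwards [ae_prod_mem hμ hν] with p hp
    rw [← two_mul_logInv_eq_lintegral hR (norm_nonneg _) (hS _ hp.1 _ hp.2)]
    simp [energyKernel]
  rw [lintegral_congr_ae h1,
    lintegral_lintegral_swap (measurable_energyKernel_density R).aemeasurable]
  exact setLIntegral_congr_fun measurableSet_Ioi fun s hs =>
    (energyDensity_eq_lintegral hS hμ hν hs).2.symm

lemma aemeasurable_energyDensity (hS : ∀ z ∈ S, ∀ t ∈ S, ‖z - t‖ ≤ R)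
    (hμ : μ Sᶜ = 0) (hν : ν Sᶜ = 0) :
    AEMeasurable (energyDensity R μ ν) (volume.restrict (Set.Ioi (0 : ℝ))) :=
  ⟨_, (measurable_energyKernel_density R).lintegral_prod_left' (μ := μ.prod ν),
    (ae_restrict_mem measurableSet_Ioi).mono fun _ hs =>
      (energyDensity_eq_lintegral hS hμ hν hs).2⟩

lemma two_mul_energyDensity_le (hS : ∀ z ∈ S, ∀ t ∈ S, ‖z - t‖ ≤ R)
    (hμ : μ Sᶜ = 0) (hν : ν Sᶜ = 0) {s : ℝ} (hs : 0 < s) :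
    2 * energyDensity R μ ν s ≤ energyDensity R μ μ s + energyDensity R ν ν s := by
  have h1 := (energyDensity_eq_lintegral hS hμ hμ hs).1
  have h2 := (energyDensity_eq_lintegral hS hν hν hs).1
  rw [energyDensity, energyDensity, energyDensity,
    ← ENNReal.ofReal_add (div_nonneg h1 hs.le) (div_nonneg h2 hs.le), ← ENNReal.ofReal_ofNat 2,
    ← ENNReal.ofReal_mul (by norm_num), ← add_div, ← mul_div_assoc]
  refine ENNReal.ofReal_le_ofReal ?_
  have := two_mul_gaussianEnergy_le hs.le μ ν
  gcongr
  linarith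

lemma two_mul_mutualEnergy_zero_le (hR : 0 < R) (hS : ∀ z ∈ S, ∀ t ∈ S, ‖z - t‖ ≤ R)
    (hμ : μ Sᶜ = 0) (hν : ν Sᶜ = 0) :
    2 * mutualEnergy R 0 μ ν ≤ mutualEnergy R 0 μ μ + mutualEnergy R 0 ν ν := by
  have h : 2 * (2 * mutualEnergy R 0 μ ν) ≤
      2 * mutualEnergy R 0 μ μ + 2 * mutualEnergy R 0 ν ν := by
    rw [two_mul_mutualEnergy_zero hR hS hμ hν, two_mul_mutualEnergy_zero hR hS hμ hμ,
      two_mul_mutualEnergy_zero hR hS hν hν, ← lintegral_const_mul' _ _ (by norm_num),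
      ← lintegral_add_left' (aemeasurable_energyDensity hS hμ hμ)]
    exact setLIntegral_mono' measurableSet_Ioi fun s hs => two_mul_energyDensity_le hS hμ hν hs
  rw [← mul_add] at h
  exact (ENNReal.mul_le_mul_iff_right (by norm_num) (by norm_num)).1 h

/-- The logarithmic energy is strictly positive definite on differences of probability measures of
finite energy. -/
lemma eq_of_mutualEnergy_zero_add_le (hR : 0 < R) (hS : ∀ z ∈ S, ∀ t ∈ S, ‖z - t‖ ≤ R)
    (hμ : μ Sᶜ = 0) (hν : ν Sᶜ = 0) (hfμ : mutualEnergy R 0 μ μ ≠ ∞)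
    (hfν : mutualEnergy R 0 ν ν ≠ ∞)
    (h : mutualEnergy R 0 μ μ + mutualEnergy R 0 ν ν ≤ 2 * mutualEnergy R 0 μ ν) : μ = ν := by
  have h' := mul_le_mul_right h 2
  have hfin : ∫⁻ s in Set.Ioi (0 : ℝ), 2 * energyDensity R μ ν s ≠ ∞ := by
    rw [lintegral_const_mul' _ _ (by norm_num), ← two_mul_mutualEnergy_zero hR hS hμ hν]
    refine ENNReal.mul_ne_top (by norm_num) (ne_top_of_le_ne_top (ENNReal.add_ne_top.2 ⟨hfμ, hfν⟩)
      (two_mul_mutualEnergy_zero_le hR hS hμ hν))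
  rw [mul_add, two_mul_mutualEnergy_zero hR hS hμ hν, two_mul_mutualEnergy_zero hR hS hμ hμ,
      two_mul_mutualEnergy_zero hR hS hν hν, ← lintegral_const_mul' _ _ (by norm_num),
      ← lintegral_add_left' (aemeasurable_energyDensity hS hμ hμ)] at h'
  -- The densities are ordered and their finite integrals agree, so they agree for almost every `s`.
  -- A single such `s > 0` suffices, by strictness of the Gaussian form.
  have hae := ae_eq_of_ae_le_of_lintegral_le
    ((ae_restrict_mem measurableSet_Ioi).mono fun s hs => two_mul_energyDensity_le hS hμ hν hs)
    hfin ((aemeasurable_energyDensity hS hμ hμ).add (aemeasurable_energyDensity hS hν hν)) h'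
  have : (ae (volume.restrict (Set.Ioi (0 : ℝ)))).NeBot := by
    rw [ae_neBot]
    intro h0
    have := congrArg (fun m => m Set.univ) h0
    simp at this
  obtain ⟨s, hse, hs⟩ := (hae.and (ae_restrict_mem measurableSet_Ioi)).exists
  have hs : 0 < s := hs
  have h1 := (energyDensity_eq_lintegral hS hμ hμ hs).1
  have h2 := (energyDensity_eq_lintegral hS hν hν hs).1
  have h3 := (energyDensity_eq_lintegral hS hμ hν hs).1
  simp only [energyDensity] at hse
  rw [← ENNReal.ofReal_add (div_nonneg h1 hs.le) (div_nonneg h2 hs.le), ← ENNReal.ofReal_ofNat 2,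
    ← ENNReal.ofReal_mul (by norm_num), ← add_div, ← mul_div_assoc,
    ENNReal.ofReal_eq_ofReal_iff (by positivity) (by positivity), div_left_inj' hs.ne'] at hse
  exact eq_of_two_mul_gaussianEnergy_eq hs (by linarith)

lemma eq_of_mutualEnergy_add_le (hR : 0 < R) (hS : ∀ z ∈ S, ∀ t ∈ S, ‖z - t‖ ≤ R)
    (hμ : μ Sᶜ = 0) (hν : ν Sᶜ = 0) {q : ℂ → ℝ≥0∞} (hq : Measurable q)
    (hfμ : mutualEnergy R q μ μ ≠ ∞) (hfν : mutualEnergy R q ν ν ≠ ∞)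
    (h : mutualEnergy R q μ μ + mutualEnergy R q ν ν ≤ 2 * mutualEnergy R q μ ν) : μ = ν := by
  rw [mutualEnergy_eq_add R hq] at hfμ hfν
  rw [mutualEnergy_eq_add R hq, mutualEnergy_eq_add R hq μ ν, mutualEnergy_eq_add R hq ν ν] at h
  simp only [ENNReal.add_ne_top] at hfμ hfν
  refine eq_of_mutualEnergy_zero_add_le hR hS hμ hν hfμ.1.1 hfν.1.1 ?_
  have hc : 2 * ∫⁻ z, q z ∂μ + 2 * ∫⁻ z, q z ∂ν ≠ ∞ := ENNReal.add_ne_top.2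
    ⟨ENNReal.mul_ne_top (by norm_num) hfμ.2, ENNReal.mul_ne_top (by norm_num) hfν.2⟩
  rw [← ENNReal.add_le_add_iff_right hc]
  calc _ = mutualEnergy R 0 μ μ + ∫⁻ z, q z ∂μ + ∫⁻ z, q z ∂μ +
        (mutualEnergy R 0 ν ν + ∫⁻ z, q z ∂ν + ∫⁻ z, q z ∂ν) := by ring
    _ ≤ _ := h
    _ = _ := by ring

end

/-! ### Uniqueness of the minimizer -/

/-- The midpoint of two probability measures. -/
def midpointMeasure (μ ν : ProbabilityMeasure ℂ) : ProbabilityMeasure ℂ :=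
  ⟨(2 : ℝ≥0∞)⁻¹ • ((μ : Measure ℂ) + (ν : Measure ℂ)), ⟨by
    simp only [Measure.smul_apply, Measure.add_apply, measure_univ, smul_eq_mul]
    rw [one_add_one_eq_two]
    exact ENNReal.inv_mul_cancel (by norm_num) (by norm_num)⟩⟩

lemma mutualEnergy_midpointMeasure (R : ℝ) {q : ℂ → ℝ≥0∞} (hq : LowerSemicontinuous q)
    (μ ν : ProbabilityMeasure ℂ) :
    4 * mutualEnergy R q (midpointMeasure μ ν) (midpointMeasure μ ν) =
      mutualEnergy R q μ μ + mutualEnergy R q ν ν + 2 * mutualEnergy R q μ ν := by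
  have h : mutualEnergy R q (midpointMeasure μ ν) (midpointMeasure μ ν) =
      2⁻¹ * (2⁻¹ * (mutualEnergy R q μ μ + mutualEnergy R q ν μ +
        (mutualEnergy R q μ ν + mutualEnergy R q ν ν))) := by
    simp only [mutualEnergy, midpointMeasure, ProbabilityMeasure.coe_mk, Measure.prod_smul_left,
      Measure.prod_smul_right, lintegral_smul_measure, Measure.prod_add, Measure.add_prod,
      lintegral_add_measure, smul_eq_mul, mul_add]
  have h4 : (4 : ℝ≥0∞) * (2⁻¹ * 2⁻¹) = 1 := by
    rw [show (4 : ℝ≥0∞) = 2 * 2 by norm_num, mul_mul_mul_comm,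
      ENNReal.mul_inv_cancel (by norm_num) (by norm_num), one_mul]
  rw [h, ← mul_assoc 2⁻¹ 2⁻¹, ← mul_assoc, h4, one_mul, mutualEnergy_comm R hq ν μ]
  ring

/-- A minimizer of the energy among the probability measures on a bounded set is unique. -/
lemma eq_of_isMinimizer {S : Set ℂ} {R : ℝ} (hR : 0 < R) (hS : ∀ z ∈ S, ∀ t ∈ S, ‖z - t‖ ≤ R)
    {q : ℂ → ℝ≥0∞} (hq : LowerSemicontinuous q) {μ ν : ProbabilityMeasure ℂ}
    (hμ : (μ : Measure ℂ) Sᶜ = 0) (hν : (ν : Measure ℂ) Sᶜ = 0)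
    (hfin : mutualEnergy R q μ μ ≠ ∞)
    (hmμ : ∀ τ : ProbabilityMeasure ℂ, (τ : Measure ℂ) Sᶜ = 0 →
      mutualEnergy R q μ μ ≤ mutualEnergy R q τ τ)
    (hmν : ∀ τ : ProbabilityMeasure ℂ, (τ : Measure ℂ) Sᶜ = 0 →
      mutualEnergy R q ν ν ≤ mutualEnergy R q τ τ) : μ = ν := by
  have heq : mutualEnergy R q ν ν = mutualEnergy R q μ μ := le_antisymm (hmν μ hμ) (hmμ ν hν)
  have hmid : (midpointMeasure μ ν : Measure ℂ) Sᶜ = 0 := by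
    simp [midpointMeasure, hμ, hν]
  have h1 := mutualEnergy_midpointMeasure R hq μ ν
  -- Minimality against the midpoint gives `4 V ≤ 2 V + 2 E(μ, ν)`; cancelling the finite `2 V`
  -- gives the reverse of the positivity inequality.
  have h2 := mul_le_mul_right (hmμ _ hmid) 4
  rw [h1, heq] at h2
  have h3 : mutualEnergy R q μ μ + mutualEnergy R q μ μ ≠ ∞ := ENNReal.add_ne_top.2 ⟨hfin, hfin⟩
  have h4 : mutualEnergy R q μ μ + mutualEnergy R q ν ν ≤ 2 * mutualEnergy R q μ ν := by
    rw [heq, ← ENNReal.add_le_add_iff_left h3]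
    refine le_trans (le_of_eq ?_) h2
    ring
  have h5 : (μ : Measure ℂ) = (ν : Measure ℂ) :=
    eq_of_mutualEnergy_add_le hR hS hμ hν hq.measurable hfin (heq ▸ hfin) h4
  exact Subtype.ext h5

/-! ### From the extended-real energy to the normalized one -/

lemma eintegral_congr_ae {α : Type*} [MeasurableSpace α] {f g : α → EReal} {μ : Measure α}
    (h : f =ᵐ[μ] g) : eintegral f μ = eintegral g μ := by
  have h1 : (fun x => (f x).toENNReal) =ᵐ[μ] fun x => (g x).toENNReal :=
    h.mono fun x hx => congrArg EReal.toENNReal hx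
  have h2 : (fun x => (-f x).toENNReal) =ᵐ[μ] fun x => (-g x).toENNReal :=
    h.mono fun x hx => congrArg (fun y => (-y).toENNReal) hx
  rw [eintegral, eintegral, lintegral_congr_ae h1, lintegral_congr_ae h2]

/-- The negative part is bounded by `c`, hence integrable. The identity `(g - c)⁺ + c = (c - g)⁺ +
g`, integrated, gives the claim whether or not `g` has finite integral. -/
lemma eintegral_coe_sub_const {α : Type*} [MeasurableSpace α] {μ : Measure α}
    [IsProbabilityMeasure μ] {g : α → ℝ≥0∞} (hg : Measurable g) {c : ℝ} (hc : 0 ≤ c) :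
    eintegral (fun x => (g x : EReal) - (c : EReal)) μ =
      ((∫⁻ x, g x ∂μ : ℝ≥0∞) : EReal) - (c : EReal) := by
  have h1 (x) : ((g x : EReal) - (c : EReal)).toENNReal = g x - ENNReal.ofReal c := by
    rw [EReal.toENNReal_sub (by exact_mod_cast hc), EReal.toENNReal_coe, EReal.real_coe_toENNReal]
  have h2 (x) : (-((g x : EReal) - (c : EReal))).toENNReal = ENNReal.ofReal c - g x := by
    rw [EReal.neg_sub (by simp) (by simp), add_comm, ← sub_eq_add_neg,
      EReal.toENNReal_sub (EReal.coe_ennreal_nonneg _), EReal.toENNReal_coe,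
      EReal.real_coe_toENNReal]
  simp_rw [eintegral, h1, h2]
  set A := ∫⁻ x, (g x - ENNReal.ofReal c) ∂μ
  set B := ∫⁻ x, (ENNReal.ofReal c - g x) ∂μ with hB
  set G := ∫⁻ x, g x ∂μ
  have hBfin : B ≠ ∞ := by
    refine ne_top_of_le_ne_top ENNReal.ofReal_ne_top (b := ENNReal.ofReal c) ?_
    calc B ≤ ∫⁻ _, ENNReal.ofReal c ∂μ := lintegral_mono fun x => tsub_le_self
      _ = _ := by simp
  have hsum : A + ENNReal.ofReal c = B + G := by
    have hcst : ENNReal.ofReal c = ∫⁻ _, ENNReal.ofReal c ∂μ := by simp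
    have h3 : A + ENNReal.ofReal c = ∫⁻ x, (g x - ENNReal.ofReal c + ENNReal.ofReal c) ∂μ := by
      rw [lintegral_add_right _ measurable_const, ← hcst]
    rw [h3, hB, ← lintegral_add_right _ hg]
    refine lintegral_congr fun x => ?_
    rw [tsub_add_eq_max, tsub_add_eq_max, max_comm]
  by_cases hG : G = ∞
  · have hA : A = ∞ := by
      rw [hG, add_top, ENNReal.add_eq_top] at hsum
      simpa using hsum
    rw [hG, hA, ← EReal.coe_ennreal_toReal hBfin, EReal.coe_ennreal_top, EReal.top_sub_coe,
      EReal.top_sub_coe]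
  · have hA : A ≠ ∞ := by
      intro hA
      rw [hA, top_add, eq_comm, ENNReal.add_eq_top] at hsum
      tauto
    have h4 := congrArg ENNReal.toReal hsum
    rw [ENNReal.toReal_add hA ENNReal.ofReal_ne_top, ENNReal.toReal_add hBfin hG,
      ENNReal.toReal_ofReal hc] at h4
    rw [← EReal.coe_ennreal_toReal hA, ← EReal.coe_ennreal_toReal hBfin,
      ← EReal.coe_ennreal_toReal hG, ← EReal.coe_sub, ← EReal.coe_sub]
    congr 1
    linarith

/-- `q` is the external field `log (W / w)` on the set `S`, where `W` is a bound for the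
nonnegative weight `w` on `S` and `R` is a bound for the diameter of `S`. -/
structure IsFieldOf (w : ℂ → ℝ) (q : ℂ → ℝ≥0∞) (S : Set ℂ) (R W : ℝ) : Prop where
  one_le_R : 1 ≤ R
  one_le_W : 1 ≤ W
  norm_sub_le : ∀ z ∈ S, ∀ t ∈ S, ‖z - t‖ ≤ R
  nonneg : ∀ z ∈ S, 0 ≤ w z
  le_W : ∀ z ∈ S, w z ≤ W
  eq_logInv : ∀ z ∈ S, q z = logInv (w z / W)
  lsc : LowerSemicontinuous q

lemma exists_isFieldOf {w : ℂ → ℝ} {S : Set ℂ} (hS : IsCompact S) (hw0 : ∀ z ∈ S, 0 ≤ w z)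
    (hw : UpperSemicontinuousOn w S) : ∃ q R W, IsFieldOf w q S R W := by
  obtain ⟨B, hB⟩ := hw.bddAbove_of_isCompact hS
  have hWpos : 0 < max 1 B := lt_max_of_lt_left one_pos
  refine ⟨fun z => logInv (S.indicator w z / max 1 B), max 1 (Metric.diam S), max 1 B,
    le_max_left _ _, le_max_left _ _, fun z hz t ht => ?_, hw0, fun z hz => ?_, fun z hz => ?_, ?_⟩
  · rw [← dist_eq_norm]
    exact (Metric.dist_le_diam_of_mem hS.isBounded hz ht).trans (le_max_right _ _)
  · exact (hB (Set.mem_image_of_mem w hz)).trans (le_max_right _ _)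
  · rw [Set.indicator_of_mem hz]
  · have husc : UpperSemicontinuous (S.indicator w) := by
      intro x y hy
      by_cases hx : x ∈ S
      · rw [Set.indicator_of_mem hx] at hy
        have h1 := hw x hx y hy
        rw [eventually_nhdsWithin_iff] at h1
        filter_upwards [h1] with t ht
        by_cases hts : t ∈ S
        · rw [Set.indicator_of_mem hts]
          exact ht hts
        · rw [Set.indicator_of_notMem hts]
          exact (hw0 x hx).trans_lt hy
      · rw [Set.indicator_of_notMem hx] at hy
        filter_upwards [hS.isClosed.isOpen_compl.mem_nhds hx] with t ht
        rwa [Set.indicator_of_notMem ht]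
    have hcont : Continuous fun x : ℝ => logInv (x / max 1 B) :=
      continuous_logInv.comp (by fun_prop)
    exact hcont.comp_upperSemicontinuous_antitone husc
      (fun x y hxy => antitone_logInv (by gcongr))

namespace IsFieldOf

variable {w : ℂ → ℝ} {q : ℂ → ℝ≥0∞} {S : Set ℂ} {R W : ℝ}

lemma R_pos (h : IsFieldOf w q S R W) : 0 < R := one_pos.trans_le h.one_le_R

lemma W_pos (h : IsFieldOf w q S R W) : 0 < W := one_pos.trans_le h.one_le_W

lemma one_le_mul (h : IsFieldOf w q S R W) : 1 ≤ R * W ^ 2 :=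
  one_le_mul_of_one_le_of_one_le h.one_le_R (one_le_pow₀ h.one_le_W)

lemma mul_pos (h : IsFieldOf w q S R W) : 0 < R * W ^ 2 := one_pos.trans_le h.one_le_mul

lemma weightedKernel_eq (h : IsFieldOf w q S R W) {z t : ℂ} (hz : z ∈ S) (ht : t ∈ S) :
    weightedKernel w z t =
      (energyKernel R q (z, t) : EReal) - (Real.log (R * W ^ 2) : ℝ) := by
  have hR := h.R_pos
  have hW := h.W_pos
  have hn : 0 ≤ ‖z - t‖ / R := by positivity
  have hn1 : ‖z - t‖ / R ≤ 1 := (div_le_one hR).2 (h.norm_sub_le z hz t ht)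
  have hu : 0 ≤ w z / W := div_nonneg (h.nonneg z hz) hW.le
  have hu1 : w z / W ≤ 1 := (div_le_one hW).2 (h.le_W z hz)
  have hv : 0 ≤ w t / W := div_nonneg (h.nonneg t ht) hW.le
  have hv1 : w t / W ≤ 1 := (div_le_one hW).2 (h.le_W t ht)
  have hk : energyKernel R q (z, t) = logInv (‖z - t‖ * w z * w t / (R * W ^ 2)) := by
    rw [energyKernel, h.eq_logInv z hz, h.eq_logInv t ht, ← logInv_mul hn hn1 hu hu1,
      ← logInv_mul (mul_nonneg hn hu) (mul_le_one₀ hn1 hu hu1) hv hv1]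
    congr 1
    field_simp
  rw [hk, weightedKernel]
  have hx : 0 ≤ ‖z - t‖ * w z * w t :=
    mul_nonneg (mul_nonneg (norm_nonneg _) (h.nonneg z hz)) (h.nonneg t ht)
  have hx1 : ‖z - t‖ * w z * w t / (R * W ^ 2) ≤ 1 := by
    calc _ = ‖z - t‖ / R * (w z / W) * (w t / W) := by field_simp
      _ ≤ 1 := mul_le_one₀ (mul_le_one₀ hn1 hu hu1) hv hv1
  generalize ‖z - t‖ * w z * w t = x at hx hx1
  rcases hx.eq_or_lt with rfl | hx
  · rw [zero_div, logInv_of_nonpos le_rfl]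
    simp
  · have hxc : 0 < x / (R * W ^ 2) := div_pos hx h.mul_pos
    have hnn : 0 ≤ -Real.log (x / (R * W ^ 2)) := by
      simpa using Real.log_nonpos hxc.le hx1
    rw [logInv_of_pos hxc, ENNReal.log_inv, ENNReal.log_ofReal_of_pos hx,
      EReal.coe_ennreal_ofReal, max_eq_left hnn, ← EReal.coe_neg, ← EReal.coe_sub,
      Real.log_div hx.ne' h.mul_pos.ne']
    congr 1
    ring

lemma weightedEnergy_eq (h : IsFieldOf w q S R W) {τ : ProbabilityMeasure ℂ}
    (hτ : (τ : Measure ℂ) Sᶜ = 0) :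
    weightedEnergy w τ = (mutualEnergy R q τ τ : EReal) - (Real.log (R * W ^ 2) : ℝ) := by
  have hm := (lowerSemicontinuous_energyKernel R h.lsc).measurable
  rw [mutualEnergy, ← eintegral_coe_sub_const hm (Real.log_nonneg h.one_le_mul), weightedEnergy]
  exact eintegral_congr_ae ((ae_prod_mem hτ hτ).mono fun p hp => h.weightedKernel_eq hp.1 hp.2)

lemma weightedEnergy_le_iff (h : IsFieldOf w q S R W) {τ σ : ProbabilityMeasure ℂ}
    (hτ : (τ : Measure ℂ) Sᶜ = 0) (hσ : (σ : Measure ℂ) Sᶜ = 0) :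
    weightedEnergy w τ ≤ weightedEnergy w σ ↔ mutualEnergy R q τ τ ≤ mutualEnergy R q σ σ := by
  rw [h.weightedEnergy_eq hτ, h.weightedEnergy_eq hσ, sub_eq_add_neg, sub_eq_add_neg,
    ← EReal.coe_neg, (EReal.addLECancellable_coe _).add_le_add_iff_right,
    EReal.coe_ennreal_le_coe_ennreal_iff]

lemma isWeightedEquilibriumMeasure_iff (h : IsFieldOf w q S R W) {K : Set ℂ} (hKS : K ⊆ S)
    {μ : ProbabilityMeasure ℂ} : IsWeightedEquilibriumMeasure w K μ ↔
      (μ : Measure ℂ) Kᶜ = 0 ∧ ∀ τ : ProbabilityMeasure ℂ, (τ : Measure ℂ) Kᶜ = 0 →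
        mutualEnergy R q μ μ ≤ mutualEnergy R q τ τ := by
  have hsub {τ : ProbabilityMeasure ℂ} (hτ : (τ : Measure ℂ) Kᶜ = 0) : (τ : Measure ℂ) Sᶜ = 0 :=
    measure_mono_null (Set.compl_subset_compl.2 hKS) hτ
  refine and_congr_right fun hμ => forall₂_congr fun τ hτ => ?_
  exact h.weightedEnergy_le_iff (hsub hμ) (hsub hτ)

/-- The field is bounded on the sets where the weight is bounded below, so that restricting a
measure of finite logarithmic energy to such a set gives a measure of finite weighted energy. -/
lemma exists_mutualEnergy_ne_top (h : IsFieldOf w q S R W) {K : Set ℂ} (hKS : K ⊆ S)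
    (hK : MeasurableSet K) (hpol : ¬ IsPolar {z | z ∈ K ∧ 0 < w z}) :
    ∃ τ : ProbabilityMeasure ℂ, (τ : Measure ℂ) Kᶜ = 0 ∧ mutualEnergy R q τ τ ≠ ∞ := by
  simp only [IsPolar, not_forall] at hpol
  obtain ⟨C, hC, hCK, τ, hτC, hτ⟩ := hpol
  have hone : IsFieldOf (fun _ => 1) 0 S R 1 :=
    ⟨h.one_le_R, le_rfl, h.norm_sub_le, fun _ _ => zero_le_one, fun _ _ => le_rfl,
      fun _ _ => by simp [logInv_one], lowerSemicontinuous_zero⟩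
  have hCS : C ⊆ S := fun z hz => hKS (hCK hz).1
  have hτS : (τ : Measure ℂ) Sᶜ = 0 := measure_mono_null (Set.compl_subset_compl.2 hCS) hτC
  have hfin : mutualEnergy R 0 τ τ ≠ ∞ := by
    intro hinf
    refine hτ ?_
    rw [logEnergy, hone.weightedEnergy_eq hτS, hinf]
    rfl
  have hqm := h.lsc.measurable
  -- The field is finite where the weight is positive, so the sets `A m` cover `C` and one of them
  -- has positive `τ`-measure; `τ` is conditioned on it.
  let A : ℕ → Set ℂ := fun m => K ∩ {z | q z ≤ m}
  have hA (m) : MeasurableSet (A m) := hK.inter (measurableSet_le hqm measurable_const)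
  have hCA : C ⊆ ⋃ m, A m := by
    intro z hz
    have hz' := hCK hz
    have hq : q z ≠ ∞ := by
      rw [h.eq_logInv z (hCS hz), logInv_ne_top_iff]
      exact div_pos hz'.2 h.W_pos
    obtain ⟨m, hm⟩ := ENNReal.exists_nat_gt hq
    exact Set.mem_iUnion.2 ⟨m, hz'.1, hm.le⟩
  obtain ⟨m, hm⟩ : ∃ m, (τ : Measure ℂ) (A m) ≠ 0 := by
    by_contra! hall
    have h0 : (τ : Measure ℂ) C = 0 := measure_mono_null hCA (measure_iUnion_null hall)
    have h1 : (τ : Measure ℂ) Set.univ = 0 := by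
      rw [← Set.union_compl_self C]
      exact measure_union_null h0 hτC
    simp at h1
  set c := ((τ : Measure ℂ) (A m))⁻¹ with hc
  have hct : c ≠ ∞ := by simpa [hc] using hm
  let σ : Measure ℂ := c • (τ : Measure ℂ).restrict (A m)
  have hσ : IsProbabilityMeasure σ := ⟨by
    simp only [σ, Measure.smul_apply, Measure.restrict_apply_univ, smul_eq_mul, hc]
    exact ENNReal.inv_mul_cancel hm (measure_ne_top _ _)⟩
  have hσA : σ (A m)ᶜ = 0 := by
    simp [σ, Measure.restrict_apply (hA m).compl]
  refine ⟨⟨σ, hσ⟩, measure_mono_null (Set.compl_subset_compl.2 Set.inter_subset_left) hσA, ?_⟩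
  change mutualEnergy R q σ σ ≠ ∞
  have hqσ : ∫⁻ z, q z ∂σ ≠ ∞ := by
    refine ne_top_of_le_ne_top (ENNReal.natCast_ne_top m) ?_
    calc ∫⁻ z, q z ∂σ ≤ ∫⁻ _, m ∂σ := lintegral_mono_ae (by
          have : ∀ᵐ z ∂σ, z ∈ A m := hσA
          exact this.mono fun z hz => hz.2)
      _ = m := by simp
  rw [mutualEnergy_eq_add R hqm]
  refine ENNReal.add_ne_top.2 ⟨ENNReal.add_ne_top.2 ⟨?_, hqσ⟩, hqσ⟩
  have hle : mutualEnergy R 0 σ σ ≤ c * (c * mutualEnergy R 0 τ τ) := by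
    simp only [mutualEnergy, σ, Measure.prod_smul_left, Measure.prod_smul_right,
      lintegral_smul_measure, smul_eq_mul, Measure.prod_restrict]
    gcongr
    exact Measure.restrict_le_self
  exact ne_top_of_le_ne_top (ENNReal.mul_ne_top hct (ENNReal.mul_ne_top hct hfin)) hle

end IsFieldOf

/-! ### Weak compactness and existence of a minimizer -/

lemma isCompact_setOf_measure_compl_eq_zero {S : Set ℂ} (hS : IsCompact S) :
    IsCompact {μ : ProbabilityMeasure ℂ | (μ : Measure ℂ) Sᶜ = 0} := by
  have := isCompact_setOfPred_probabilityMeasure_mass_eq_compl_isCompact_le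
    (E := ℂ) (u := fun _ => 0) (K := fun _ => S) tendsto_const_nhds (fun _ => hS)
    (Or.inl inferInstance)
  convert this using 1
  ext μ
  simp [ProbabilityMeasure.null_iff_toMeasure_null]

lemma measure_compl_eq_zero_of_tendsto {S : Set ℂ} (hS : IsClosed S)
    {μs : ℕ → ProbabilityMeasure ℂ} {μ : ProbabilityMeasure ℂ} (h : Tendsto μs atTop (𝓝 μ))
    (hμs : ∀ᶠ n in atTop, (μs n : Measure ℂ) Sᶜ = 0) : (μ : Measure ℂ) Sᶜ = 0 := by
  have h1 := ProbabilityMeasure.le_liminf_measure_open_of_tendsto h hS.isOpen_compl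
  rw [liminf_congr hμs, liminf_const] at h1
  exact le_antisymm h1 zero_le

lemma tendsto_prod_self {μs : ℕ → ProbabilityMeasure ℂ} {μ : ProbabilityMeasure ℂ}
    (h : Tendsto μs atTop (𝓝 μ)) :
    Tendsto (fun n => (μs n).prod (μs n)) atTop (𝓝 (μ.prod μ)) :=
  (ProbabilityMeasure.continuous_prod.tendsto (μ, μ)).comp (h.prodMk_nhds h)

/-- Direct method: a minimizing sequence has a weak limit point carried by `K`, and the energy is
lower semicontinuous. -/
lemma exists_isMinimizer {K : Set ℂ} (hK : IsCompact K) (R : ℝ) {q : ℂ → ℝ≥0∞}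
    (hq : LowerSemicontinuous q)
    (hne : ∃ τ : ProbabilityMeasure ℂ, (τ : Measure ℂ) Kᶜ = 0) :
    ∃ μ : ProbabilityMeasure ℂ, (μ : Measure ℂ) Kᶜ = 0 ∧
      ∀ τ : ProbabilityMeasure ℂ, (τ : Measure ℂ) Kᶜ = 0 →
        mutualEnergy R q μ μ ≤ mutualEnergy R q τ τ := by
  let P := {μ : ProbabilityMeasure ℂ | (μ : Measure ℂ) Kᶜ = 0}
  let J : ProbabilityMeasure ℂ → ℝ≥0∞ := fun μ => mutualEnergy R q μ μ
  have hP : P.Nonempty := hne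
  obtain ⟨u, -, hu, huP⟩ := exists_seq_tendsto_sInf (hP.image J) (OrderBot.bddBelow _)
  choose τ hτ hτu using huP
  obtain ⟨μ, hμ, φ, hφ, hlim⟩ := (isCompact_setOf_measure_compl_eq_zero hK).tendsto_subseq hτ
  refine ⟨μ, hμ, fun σ hσ => ?_⟩
  have h1 := lintegral_le_liminf_of_tendsto (lowerSemicontinuous_energyKernel R hq)
    (tendsto_prod_self hlim)
  have h2 : Tendsto (fun n => J ((τ ∘ φ) n)) atTop (𝓝 (sInf (J '' P))) := by
    simp only [Function.comp, hτu]
    exact hu.comp hφ.tendsto_atTop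
  calc J μ ≤ _ := h1
    _ = sInf (J '' P) := h2.liminf_eq
    _ ≤ J σ := sInf_le (Set.mem_image_of_mem J hσ)

/-! ### Energy of limits of counting measures -/

lemma countingMeasure_compl_eq_zero {S : Set ℂ} (hS : MeasurableSet S) {n : ℕ}
    {z : Fin (n + 1) → ℂ} (hz : ∀ j, z j ∈ S) : (countingMeasure z : Measure ℂ) Sᶜ = 0 := by
  simp [countingMeasure, Measure.dirac_apply' _ hS.compl, hz]

/-- An upper bound for the discrete energies of configurations passes to the energy of the weak
limit of the normalized counting measures. -/
lemma mutualEnergy_le_of_tendsto_countingMeasure (R : ℝ) {q : ℂ → ℝ≥0∞}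
    (hq : LowerSemicontinuous q) {z : (n : ℕ) → Fin (n + 1) → ℂ} {φ : ℕ → ℕ} (hφ : StrictMono φ)
    {σ : ProbabilityMeasure ℂ}
    (hσ : Tendsto (fun k => countingMeasure (z (φ k))) atTop (𝓝 σ)) {b : ℝ≥0∞}
    (hb : ∀ᶠ k in atTop, ∑ i, ∑ j ∈ Finset.Ioi i, energyKernel R q (z (φ k) i, z (φ k) j) ≤
      ((φ k + 1).choose 2 : ℕ) * b) : mutualEnergy R q σ σ ≤ b := by
  have hlsc := lowerSemicontinuous_energyKernel R hq
  rw [mutualEnergy, lintegral_eq_iSup_min _ hlsc.measurable]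
  -- For fixed `M` the diagonal error `M / (φ k + 1)` vanishes in the limit; only afterwards is the
  -- supremum over `M` taken.
  refine iSup_le fun M => ?_
  have h1 := lintegral_le_liminf_of_tendsto (lowerSemicontinuous_min_const hlsc (M : ℝ≥0∞))
    (tendsto_prod_self hσ)
  refine h1.trans ?_
  have hlim : Tendsto (fun k => ((φ k : ℝ≥0∞) + 1)⁻¹ * M + b) atTop (𝓝 b) := by
    have h2 : Tendsto (fun n : ℕ => ((n : ℝ≥0∞) + 1)⁻¹) atTop (𝓝 0) := by
      have := (tendsto_add_atTop_iff_nat 1).2 ENNReal.tendsto_inv_nat_nhds_zero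
      simpa using this
    have h3 := ENNReal.Tendsto.mul_const (b := (M : ℝ≥0∞)) (h2.comp hφ.tendsto_atTop)
      (Or.inr (ENNReal.natCast_ne_top M))
    simpa using h3.add_const b
  rw [← hlim.liminf_eq]
  refine liminf_le_liminf (hb.mono fun k hk => ?_)
  refine (lintegral_min_energyKernel_countingMeasure_le R hq M (z (φ k))).trans ?_
  gcongr
  calc _ ≤ (((φ k + 1).choose 2 : ℕ) : ℝ≥0∞)⁻¹ * (((φ k + 1).choose 2 : ℕ) * b) := by gcongr
    _ = (((φ k + 1).choose 2 : ℕ) : ℝ≥0∞)⁻¹ * ((φ k + 1).choose 2 : ℕ) * b := by rw [mul_assoc]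
    _ ≤ 1 * b := by
      gcongr
      exact ENNReal.inv_mul_le_one _
    _ = b := one_mul b

lemma choose_two_pos {n : ℕ} (hn : 1 ≤ n) : 0 < (n + 1).choose 2 := Nat.choose_pos (by omega)

/-! ### Asymptotics of the weighted diameters -/

namespace IsFieldOf

variable {w : ℂ → ℝ} {q : ℂ → ℝ≥0∞} {S : Set ℂ} {R W : ℝ}

lemma weightedVDM_nonneg (h : IsFieldOf w q S R W) {n : ℕ} {z : Fin (n + 1) → ℂ}
    (hz : ∀ j, z j ∈ S) : 0 ≤ weightedVDM w n z :=
  mul_nonneg (norm_nonneg _) (Finset.prod_nonneg fun j _ => pow_nonneg (h.nonneg _ (hz j)) _)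

lemma weightedVDM_le (h : IsFieldOf w q S R W) {n : ℕ} {z : Fin (n + 1) → ℂ}
    (hz : ∀ j, z j ∈ S) : weightedVDM w n z ≤ (R * W ^ 2) ^ (n + 1).choose 2 := by
  have hnn (i j) : 0 ≤ ‖z i - z j‖ * (w (z i) * w (z j)) :=
    mul_nonneg (norm_nonneg _) (mul_nonneg (h.nonneg _ (hz i)) (h.nonneg _ (hz j)))
  rw [weightedVDM_eq_prod, ← prod_pairs_const]
  refine Finset.prod_le_prod (fun i _ => Finset.prod_nonneg fun j _ => hnn i j) fun i _ =>
    Finset.prod_le_prod (fun j _ => hnn i j) fun j _ => ?_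
  rw [sq]
  exact mul_le_mul (h.norm_sub_le _ (hz i) _ (hz j))
    (mul_le_mul (h.le_W _ (hz i)) (h.le_W _ (hz j)) (h.nonneg _ (hz j)) h.W_pos.le)
    (mul_nonneg (h.nonneg _ (hz i)) (h.nonneg _ (hz j))) h.R_pos.le

lemma rpow_div_le_one (h : IsFieldOf w q S R W) {n : ℕ} (hn : 1 ≤ n) {x : ℝ} (hx : 0 ≤ x)
    (hx1 : x ≤ (R * W ^ 2) ^ (n + 1).choose 2) :
    x ^ (1 / ((n + 1).choose 2 : ℝ)) / (R * W ^ 2) ≤ 1 := by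
  rw [div_le_one h.mul_pos]
  calc x ^ (1 / ((n + 1).choose 2 : ℝ))
      ≤ ((R * W ^ 2) ^ (n + 1).choose 2) ^ (1 / ((n + 1).choose 2 : ℝ)) := by gcongr
    _ = R * W ^ 2 := by
      rw [one_div, Real.pow_rpow_inv_natCast h.mul_pos.le (choose_two_pos hn).ne']

lemma choose_mul_logInv (h : IsFieldOf w q S R W) {n : ℕ} (hn : 1 ≤ n) {z : Fin (n + 1) → ℂ}
    (hz : ∀ j, z j ∈ S) :
    ((n + 1).choose 2 : ℕ) *
        logInv (weightedVDM w n z ^ (1 / ((n + 1).choose 2 : ℝ)) / (R * W ^ 2)) =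
      ∑ i, ∑ j ∈ Finset.Ioi i, energyKernel R q (z i, z j) := by
  have h0 := h.weightedVDM_nonneg hz
  rw [← logInv_pow (div_nonneg (Real.rpow_nonneg h0 _) h.mul_pos.le)
      (h.rpow_div_le_one hn h0 (h.weightedVDM_le hz)), div_pow, one_div,
    Real.rpow_inv_natCast_pow h0 (choose_two_pos hn).ne',
    logInv_weightedVDM h.R_pos h.W_pos (fun i j => h.norm_sub_le _ (hz i) _ (hz j))
      (fun i => h.nonneg _ (hz i)) (fun i => h.le_W _ (hz i)) (fun i => h.eq_logInv _ (hz i))]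

lemma mutualEnergy_le_logInv (h : IsFieldOf w q S R W) {z : (n : ℕ) → Fin (n + 1) → ℂ}
    {φ : ℕ → ℕ} (hφ : StrictMono φ) (hz : ∀ᶠ k in atTop, ∀ j, z (φ k) j ∈ S)
    {σ : ProbabilityMeasure ℂ}
    (hσ : Tendsto (fun k => countingMeasure (z (φ k))) atTop (𝓝 σ)) {a : ℝ}
    (ha : ∀ᶠ k in atTop, a ≤
      weightedVDM w (φ k) (z (φ k)) ^ (1 / ((φ k + 1).choose 2 : ℝ)) / (R * W ^ 2)) :
    mutualEnergy R q σ σ ≤ logInv a := by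
  refine mutualEnergy_le_of_tendsto_countingMeasure R h.lsc hφ hσ ?_
  filter_upwards [hz, ha, hφ.tendsto_atTop.eventually_ge_atTop 1] with k hk hak hk1
  rw [← h.choose_mul_logInv hk1 hk]
  gcongr
  exact antitone_logInv hak

lemma bddAbove_weightedVDM (h : IsFieldOf w q S R W) {K : Set ℂ} (hKS : K ⊆ S) (n : ℕ) :
    BddAbove (Set.range fun z : Fin (n + 1) → K => weightedVDM w n (fun j => (z j : ℂ))) :=
  ⟨_, Set.forall_mem_range.2 fun z => h.weightedVDM_le fun j => hKS (z j).2⟩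

lemma iSup_weightedVDM_nonneg (h : IsFieldOf w q S R W) {K : Set ℂ} (hKS : K ⊆ S) (n : ℕ) :
    0 ≤ ⨆ z : Fin (n + 1) → K, weightedVDM w n (fun j => (z j : ℂ)) :=
  Real.iSup_nonneg fun z => h.weightedVDM_nonneg fun j => hKS (z j).2

lemma weightedDiameter_div_le_one (h : IsFieldOf w q S R W) {K : Set ℂ} (hKS : K ⊆ S) {n : ℕ}
    (hn : 1 ≤ n) : weightedDiameter w K n / (R * W ^ 2) ≤ 1 :=
  h.rpow_div_le_one hn (h.iSup_weightedVDM_nonneg hKS n)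
    (Real.iSup_le (fun z => h.weightedVDM_le fun j => hKS (z j).2) (pow_nonneg h.mul_pos.le _))

/-- Every configuration in `K` has pair energy at least that of the extremal value, and the mean
over independent `τ`-distributed points is the number of pairs times the energy of `τ`. -/
lemma logInv_weightedDiameter_le (h : IsFieldOf w q S R W) {K : Set ℂ} (hKS : K ⊆ S)
    {τ : ProbabilityMeasure ℂ} (hτ : (τ : Measure ℂ) Kᶜ = 0) {n : ℕ} (hn : 1 ≤ n) :
    logInv (weightedDiameter w K n / (R * W ^ 2)) ≤ mutualEnergy R q τ τ := by
  have hC : (((n + 1).choose 2 : ℕ) : ℝ≥0∞) ≠ 0 := by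
    exact_mod_cast (choose_two_pos hn).ne'
  rw [← ENNReal.mul_le_mul_iff_right hC (ENNReal.natCast_ne_top _)]
  refine le_choose_mul_mutualEnergy R h.lsc (τ : Measure ℂ) hτ n fun z hz => ?_
  have hzS (j) : z j ∈ S := hKS (hz j)
  rw [← h.choose_mul_logInv hn hzS]
  gcongr
  refine antitone_logInv (div_le_div_of_nonneg_right (Real.rpow_le_rpow
    (h.weightedVDM_nonneg hzS) ?_ (by positivity)) h.mul_pos.le)
  exact le_ciSup (h.bddAbove_weightedVDM hKS n) (fun j => (⟨z j, hz j⟩ : K))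

/-- Near-maximizers suffice, so attainment of the supremum is never needed. -/
lemma exists_lt_weightedVDM (h : IsFieldOf w q S R W) {K : Set ℂ} (hKS : K ⊆ S)
    (hne : K.Nonempty) {n : ℕ} (hn : 1 ≤ n) {a : ℝ} (ha0 : 0 ≤ a)
    (ha : a < weightedDiameter w K n / (R * W ^ 2)) :
    ∃ z : Fin (n + 1) → ℂ, (∀ j, z j ∈ K) ∧
      a ≤ weightedVDM w n z ^ (1 / ((n + 1).choose 2 : ℝ)) / (R * W ^ 2) := by
  by_contra! hall
  refine ha.not_ge ?_
  have := hne.to_subtype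
  have hC := (choose_two_pos hn).ne'
  have hac : 0 ≤ a * (R * W ^ 2) := mul_nonneg ha0 h.mul_pos.le
  rw [div_le_iff₀ h.mul_pos, weightedDiameter]
  calc _ ≤ ((a * (R * W ^ 2)) ^ (n + 1).choose 2) ^ (1 / ((n + 1).choose 2 : ℝ)) := by
        refine Real.rpow_le_rpow (h.iSup_weightedVDM_nonneg hKS n) (ciSup_le fun z => ?_)
          (by positivity)
        have hzS (j) : (z j : ℂ) ∈ S := hKS (z j).2
        have h1 := hall (fun j => z j) fun j => (z j).2
        rw [div_lt_iff₀ h.mul_pos] at h1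
        have h2 := pow_le_pow_left₀ (Real.rpow_nonneg (h.weightedVDM_nonneg hzS) _) h1.le
          ((n + 1).choose 2)
        rwa [one_div, Real.rpow_inv_natCast_pow (h.weightedVDM_nonneg hzS) hC] at h2
    _ = _ := by rw [one_div, Real.pow_rpow_inv_natCast hac hC]

/-- The weighted diameters converge to the exponential of minus the minimal energy. -/
lemma tendsto_weightedDiameter (h : IsFieldOf w q S R W) {K : Set ℂ} (hKS : K ⊆ S)
    (hK : IsCompact K) (hne : K.Nonempty) {μ : ProbabilityMeasure ℂ}
    (hμ : (μ : Measure ℂ) Kᶜ = 0) (hfin : mutualEnergy R q μ μ ≠ ∞)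
    (hmin : ∀ τ : ProbabilityMeasure ℂ, (τ : Measure ℂ) Kᶜ = 0 →
      mutualEnergy R q μ μ ≤ mutualEnergy R q τ τ) :
    Tendsto (weightedDiameter w K) atTop
      (𝓝 (Real.exp (-(mutualEnergy R q μ μ).toReal) * (R * W ^ 2))) := by
  set v := (mutualEnergy R q μ μ).toReal with hv
  have hV : mutualEnergy R q μ μ = ENNReal.ofReal v := (ENNReal.ofReal_toReal hfin).symm
  suffices hlim : Tendsto (fun n => weightedDiameter w K n / (R * W ^ 2)) atTop
      (𝓝 (Real.exp (-v))) by
    refine (hlim.mul_const (R * W ^ 2)).congr fun n => ?_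
    exact div_mul_cancel₀ _ h.mul_pos.ne'
  refine tendsto_order.2 ⟨fun a ha => ?_, fun b hb => ?_⟩
  · filter_upwards [eventually_ge_atTop 1] with n hn
    refine ha.trans_le (exp_neg_le_of_logInv_le ENNReal.toReal_nonneg ?_)
    rw [← hV]
    exact h.logInv_weightedDiameter_le hKS hμ hn
  -- If the diameters exceed some `a > exp (-v)` infinitely often, near-maximizers along a
  -- subsequence have a limit measure on `K` of energy at most `logInv a`, below the minimum.
  · by_contra hcon
    have hfreq : ∃ᶠ n in atTop, b ≤ weightedDiameter w K n / (R * W ^ 2) := by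
      simpa only [not_eventually, not_lt] using hcon
    obtain ⟨a, hva, hab⟩ := exists_between hb
    have hex : ∃ᶠ n in atTop, 1 ≤ n ∧ a < weightedDiameter w K n / (R * W ^ 2) :=
      (hfreq.and_eventually (eventually_ge_atTop 1)).mono fun n hn => ⟨hn.2, hab.trans_le hn.1⟩
    have ha1 : a ≤ 1 := by
      obtain ⟨n, hn, han⟩ := hex.exists
      exact han.le.trans (h.weightedDiameter_div_le_one hKS hn)
    obtain ⟨φ, hφ, hφa⟩ := extraction_of_frequently_atTop hex
    have hz : ∀ n, ∃ z : Fin (n + 1) → ℂ, (∀ j, z j ∈ K) ∧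
        ((1 ≤ n ∧ a < weightedDiameter w K n / (R * W ^ 2)) →
          a ≤ weightedVDM w n z ^ (1 / ((n + 1).choose 2 : ℝ)) / (R * W ^ 2)) := by
      intro n
      by_cases hn : 1 ≤ n ∧ a < weightedDiameter w K n / (R * W ^ 2)
      · obtain ⟨z, hzK, hza⟩ := h.exists_lt_weightedVDM hKS hne hn.1
          ((Real.exp_pos _).le.trans hva.le) hn.2
        exact ⟨z, hzK, fun _ => hza⟩
      -- Arbitrary points of `K` at the indices off the subsequence.
      · exact ⟨fun _ => hne.some, fun _ => hne.some_mem, fun h' => absurd h' hn⟩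
    choose z hzK hza using hz
    obtain ⟨σ, hσ, ψ, hψ, hlim⟩ := (isCompact_setOf_measure_compl_eq_zero hK).tendsto_subseq
      (x := fun k => countingMeasure (z (φ k)))
      fun k => countingMeasure_compl_eq_zero hK.measurableSet (hzK _)
    have hle := h.mutualEnergy_le_logInv (hφ.comp hψ) (z := z)
      (Eventually.of_forall fun k j => hKS (hzK _ j)) hlim
      (Eventually.of_forall fun k => hza _ (hφa _))
    exact ((hmin σ hσ).trans hle).not_gt (hV ▸ logInv_lt_of_exp_neg_lt ha1 hva)

end IsFieldOf

end WeightedPotential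

end

/-! ### The proposition -/

theorem proposition2p1 (K : Set ℂ) (hK : IsCompact K)
    (hKpolar : ¬ WeightedPotential.IsPolar K)
    (Kn : ℕ → Set ℂ) (hKn : ∀ n, IsCompact (Kn n)) (hdecr : ∀ n, Kn (n + 1) ⊆ Kn n)
    (hinter : K = ⋂ n, Kn n)
    (w : ℂ → ℝ) (n₀ : ℕ)
    (hwn : ∀ n, n₀ ≤ n → WeightedPotential.IsAdmissibleWeight w (Kn n))
    (hw : WeightedPotential.IsAdmissibleWeight w K) :
    Tendsto (WeightedPotential.weightedDiameter w K) atTop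
        (𝓝 (WeightedPotential.weightedTransfiniteDiameter w K)) ∧
      ∃ μ : ProbabilityMeasure ℂ,
        WeightedPotential.IsWeightedEquilibriumMeasure w K μ ∧
        (∀ ν, WeightedPotential.IsWeightedEquilibriumMeasure w K ν → ν = μ) ∧
        ∀ z : (n : ℕ) → Fin (n + 1) → ℂ,
          (∀ n, 1 ≤ n → ∀ j, z n j ∈ Kn n) →
          Tendsto (fun n => WeightedPotential.weightedVDM w n (z n) ^
              (1 / ((n + 1).choose 2 : ℝ))) atTop
            (𝓝 (WeightedPotential.weightedTransfiniteDiameter w K)) →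
          Tendsto (fun n => WeightedPotential.countingMeasure (z n)) atTop (𝓝 μ) := by
  open WeightedPotential in
  obtain ⟨q, R, W, h⟩ := exists_isFieldOf (hKn n₀) (hwn n₀ le_rfl).nonneg
    (hwn n₀ le_rfl).upperSemicontinuousOn
  have hKsub (n : ℕ) : K ⊆ Kn n := hinter ▸ Set.iInter_subset _ _
  have hKS := hKsub n₀
  have hanti : Antitone Kn := antitone_nat_of_succ_le hdecr
  obtain ⟨τ, hτK, hτ⟩ := h.exists_mutualEnergy_ne_top hKS hK.measurableSet hw.nonpolar
  have hne : K.Nonempty := by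
    rw [Set.nonempty_iff_ne_empty]
    rintro rfl
    simp at hτK
  obtain ⟨μ, hμK, hmin⟩ := exists_isMinimizer hK R h.lsc ⟨τ, hτK⟩
  have hfin : mutualEnergy R q μ μ ≠ ∞ := ne_top_of_le_ne_top hτ (hmin τ hτK)
  have hsub (z) (hz : z ∈ K) (t) (ht : t ∈ K) : ‖z - t‖ ≤ R :=
    h.norm_sub_le z (hKS hz) t (hKS ht)
  have huniq (ν : ProbabilityMeasure ℂ) (hν : (ν : Measure ℂ) Kᶜ = 0)
      (hle : mutualEnergy R q ν ν ≤ mutualEnergy R q μ μ) : ν = μ :=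
    (eq_of_isMinimizer h.R_pos hsub h.lsc hμK hν hfin hmin
      fun τ hτ => hle.trans (hmin τ hτ)).symm
  have hdiam := h.tendsto_weightedDiameter hKS hK hne hμK hfin hmin
  have hδ : weightedTransfiniteDiameter w K = _ := hdiam.limUnder_eq
  rw [hδ]
  refine ⟨hdiam, μ, (h.isWeightedEquilibriumMeasure_iff hKS).2 ⟨hμK, hmin⟩, fun ν hν => ?_,
    fun z hz hlim => ?_⟩
  · rw [h.isWeightedEquilibriumMeasure_iff hKS] at hν
    exact huniq ν hν.1 (hν.2 μ hμK)
  have hzmem (m : ℕ) : ∀ᶠ n in atTop, ∀ j, z n j ∈ Kn m := by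
    filter_upwards [eventually_ge_atTop (max m 1)] with n hn j
    exact hanti (le_of_max_le_left hn) (hz n (le_of_max_le_right hn) j)
  have hmeas (m : ℕ) : ∀ᶠ n in atTop, (countingMeasure (z n) : Measure ℂ) (Kn m)ᶜ = 0 :=
    (hzmem m).mono fun n hn => countingMeasure_compl_eq_zero (hKn m).measurableSet hn
  -- The counting measures eventually lie in a weakly compact set, so it is enough that `μ` is their
  -- only cluster point.
  refine (isCompact_setOf_measure_compl_eq_zero (hKn n₀)).tendsto_nhds_of_unique_mapClusterPt
    (hmeas n₀) fun σ _ hσ => ?_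
  obtain ⟨φ, hφ, hφσ⟩ := hσ.tendsto_subseq
  have hσK : (σ : Measure ℂ) Kᶜ = 0 := by
    rw [hinter, Set.compl_iInter]
    exact measure_iUnion_null fun m => measure_compl_eq_zero_of_tendsto (hKn m).isClosed hφσ
      (hφ.tendsto_atTop.eventually (hmeas m))
  refine huniq σ hσK ?_
  have hlim' : Tendsto (fun n => weightedVDM w n (z n) ^ (1 / ((n + 1).choose 2 : ℝ)) /
      (R * W ^ 2)) atTop (𝓝 (Real.exp (-(mutualEnergy R q μ μ).toReal))) := by
    have := hlim.div_const (R * W ^ 2)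
    rwa [mul_div_cancel_right₀ _ h.mul_pos.ne'] at this
  have hle : ∀ a < Real.exp (-(mutualEnergy R q μ μ).toReal),
      mutualEnergy R q σ σ ≤ logInv a := fun a ha =>
    h.mutualEnergy_le_logInv hφ (hφ.tendsto_atTop.eventually (hzmem n₀)) hφσ
      ((hφ.tendsto_atTop.eventually (hlim'.eventually_const_lt ha)).mono fun _ hk => hk.le)
  -- Letting `a` increase to `exp (-V)`, continuity of `logInv` bounds the energy of `σ` by `V`.
  have h1 := ge_of_tendsto (continuous_logInv.continuousWithinAt.tendsto
    (x := Real.exp (-(mutualEnergy R q μ μ).toReal)) (s := Set.Iio _))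
    (eventually_nhdsWithin_of_forall fun a ha => hle a ha)
  rwa [logInv_exp_neg, ENNReal.ofReal_toReal hfin] at h1
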